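/- Let $\mathcal{G}_d=(\mathcal{V},\mathcal{E})$ be a connected, locally finite, simple graph with countably infinitely many vertices and edges, and let $\mathcal{G}$ be the metric graph obtained by assigning to each edge $e$ a length $|e|\in(0,\infty)$, identifying $e$ with $[0,|e|]$ and gluing the edges together at the vertices. Let $$H^1(\mathcal{G})=\Big\{f:\mathcal{G}\to\mathbb{C}\ \text{continuous}\ \Big|\ f|_e\in H^1(e)\ \text{for all } e\in\mathcal{E},\ \|f\|_{H^1(\mathcal{G})}^2:=\sum_{e\in\mathcal{E}}\int_e\big(|f|^2+|f'|^2\big)\,dx<\infty\Big\},$$ where $H^1(e)$ is the space of absolutely continuous functions on $e$ with derivative in $L^2(e)$. A topological end of $\mathcal{G}$ is an equivalence class of sequences $(U_n)_{n\ge0}$ of non-empty connected open subsets of $\mathcal{G}$ with compact boundaries such that $U_{n+1}\subseteq U_n$ for all $n$ and $\bigcap_n\overline{U_n}=\varnothing$; two sequences are equivalent if each member of either one contains a member of the other. Let $\mathfrak{C}(\mathcal{G})$ be the set of topological ends. The end compactification is $\widehat{\mathcal{G}}=\mathcal{G}\cup\mathfrak{C}(\mathcal{G})$, with the topology whose basis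 consists of the sets $\widehat U=U\cup\{\gamma\in\mathfrak{C}(\mathcal{G}) : \text{some } (U_n)\in\gamma \text{ has } U_0\subseteq U\}$, $U\subseteq\mathcal{G}$ open. A ray is a sequence $(v_n)_{n\ge0}$ of distinct vertices with $v_n$ adjacent to $v_{n+1}$ for all $n$; it is identified with the union of its edges. Two rays are equivalent if a third ray contains infinitely many vertices of both, and a graph end is an equivalence class of rays. The graph end $\omega_\gamma$ corresponding to $\gamma\in\mathfrak{C}(\mathcal{G})$ is the one such that, for every $(U_n)\in\gamma$, each $U_n$ contains a ray from $\omega_\gamma$. Then each $f\in H^1(\mathcal{G})$ has a unique continuous extension, again denoted by $f$, to $\widehat{\mathcal{G}}$, and its values at the ends are $$f(\gamma)=\lim_{n\to\infty}f(v_n)\qquad\text{for every } \gamma\in\mathfrak{C}(\mathcal{G}) \text{ and every ray } (v_n)_{n\ge0}\in\omega_\gamma .$$ Moreover, $$\|f\|_\infty:=\sup_{x\in\mathcal{G}}|f(x)|=\sup_{x\in\widehat{\mathcal{G}}}|f(x)|\le C_{\mathcal{G}}\,\|f\|_{H^1(\mathcal{G})},\qquad C_{\mathcal{G}}=\sqrt{\coth\big(\tfrac12\operatorname{diam}(\mathcal{G})\big)},$$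 where $\operatorname{diam}(\mathcal{G})\in(0,\infty]$ is the supremum of the lengths (sums of edge lengths) of all paths without self-intersections in $\mathcal{G}_d$, and $\coth\infty=1$. -/

import Mathlib

open MeasureTheory Filter Topology
open scoped ENNReal

/-- A metric graph: a simple graph, a finite positive length for every edge and, in order to
identify an edge `e` with the interval `[0, |e|]`, a direction of every edge. Connectedness, local
finiteness and countable infiniteness are hypotheses of the theorem. -/
structure MetricGraph (V : Type*) where
  /-- the underlying combinatorial graph -/
  graph : SimpleGraph V
  /-- the edge lengths -/
  len : graph.edgeSet → ℝ
  len_pos : ∀ e, 0 < len e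
  /-- initial vertex of an edge -/
  src : graph.edgeSet → V
  /-- terminal vertex of an edge -/
  tgt : graph.edgeSet → V
  ends : ∀ e, s(src e, tgt e) = e.1

/-- A ray in a simple graph: an infinite sequence of distinct, consecutively adjacent vertices. -/
structure GraphRay {V : Type*} (G : SimpleGraph V) where
  /-- the vertices of the ray -/
  vert : ℕ → V
  injective : Function.Injective vert
  adj : ∀ n, G.Adj (vert n) (vert (n + 1))

namespace GraphRay

variable {V : Type*} {G : SimpleGraph V}

/-- Two rays are equivalent if a third ray contains infinitely many vertices of both. -/
def Equivalent (R₁ R₂ : GraphRay G) : Prop :=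
  ∃ R₃ : GraphRay G,
    (Set.range R₃.vert ∩ Set.range R₁.vert).Infinite ∧
    (Set.range R₃.vert ∩ Set.range R₂.vert).Infinite

/-- The `n`-th edge of a ray. -/
def edge (R : GraphRay G) (n : ℕ) : G.edgeSet :=
  ⟨s(R.vert n, R.vert (n + 1)), R.adj n⟩

end GraphRay

/-- The graph ends of `G`: equivalence classes of rays. -/
def GraphEnd {V : Type*} (G : SimpleGraph V) : Type _ :=
  Quot (GraphRay.Equivalent (G := G))

/-- The ray `R` belongs to the graph end `ω`. -/
def GraphRay.BelongsTo {V : Type*} {G : SimpleGraph V} (R : GraphRay G) (ω : GraphEnd G) : Prop :=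
  Quot.mk _ R = ω

namespace MetricGraph

variable {V : Type*} (M : MetricGraph V)

/-- The points of the metric graph: the vertices, and the interior points of the edges. -/
inductive Point : Type _
  | vertex (v : V) : Point
  | inner (e : M.graph.edgeSet) (t : Set.Ioo (0 : ℝ) (M.len e)) : Point

open Classical in
/-- The point of the edge `e` with coordinate `t ∈ [0, |e|]`; the endpoints `0` and `|e|` are
glued to the initial and the terminal vertex. (Values of `t` outside `[0, |e|]` are sent to the
nearest endpoint.) -/
noncomputable def edgePt (e : M.graph.edgeSet) (t : ℝ) : M.Point :=
  if h₀ : t ≤ 0 then .vertex (M.src e)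
  else if h₁ : M.len e ≤ t then .vertex (M.tgt e)
  else .inner e ⟨t, not_le.1 h₀, not_le.1 h₁⟩

/-- The topology of the edges `[0, |e|]` glued together at the vertices: a set is open iff its
trace on every edge `[0, |e|]` is open. -/
noncomputable instance : TopologicalSpace M.Point :=
  ⨆ e : M.graph.edgeSet,
    TopologicalSpace.coinduced (fun t : Set.Icc (0 : ℝ) (M.len e) => M.edgePt e t) inferInstance

/-! ### Ends -/

/-- Decreasing sequences of nonempty connected open sets with compact boundaries, whose closures
have empty intersection. -/
structure EndSeq where
  /-- the members of the sequence -/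
  U : ℕ → Set M.Point
  isOpen : ∀ n, IsOpen (U n)
  isConnected : ∀ n, IsConnected (U n)
  isCompact_frontier : ∀ n, IsCompact (frontier (U n))
  decreasing : ∀ n, U (n + 1) ⊆ U n
  iInter_closure : ⋂ n, closure (U n) = ∅

/-- Two sequences are equivalent if each member of either one contains a member of the other. -/
instance endSetoid : Setoid M.EndSeq where
  r s s' := ∀ n, (∃ j, s'.U j ⊆ s.U n) ∧ ∃ k, s.U k ⊆ s'.U n
  iseqv :=
    { refl := fun _ n => ⟨⟨n, subset_rfl⟩, ⟨n, subset_rfl⟩⟩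
      symm := fun h n => ⟨(h n).2, (h n).1⟩
      trans := by
        intro a b c h h' n
        refine ⟨?_, ?_⟩
        · obtain ⟨j, hj⟩ := (h n).1
          obtain ⟨k, hk⟩ := (h' j).1
          exact ⟨k, hk.trans hj⟩
        · obtain ⟨j, hj⟩ := (h' n).2
          obtain ⟨k, hk⟩ := (h j).2
          exact ⟨k, hk.trans hj⟩ }

/-- The topological ends of the metric graph. -/
def TopEnd : Type _ := Quotient M.endSetoid

/-- The sequence `s` represents the topological end `γ`. -/
def EndSeq.Represents {M : MetricGraph V} (s : M.EndSeq) (γ : M.TopEnd) : Prop :=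
  Quotient.mk M.endSetoid s = γ

/-- A ray as a subset of the metric graph: the union of its closed edges. -/
def rayCarrier (R : GraphRay M.graph) : Set M.Point :=
  ⋃ n, M.edgePt (R.edge n) '' Set.Icc 0 (M.len (R.edge n))

/-- `ω` is the graph end `ω_γ` corresponding to the topological end `γ`: for every sequence
representing `γ`, each of its members contains a ray from `ω`. -/
def Corresponds (γ : M.TopEnd) (ω : GraphEnd M.graph) : Prop :=
  ∀ s : M.EndSeq, s.Represents γ →
    ∀ n, ∃ R : GraphRay M.graph, R.BelongsTo ω ∧ M.rayCarrier R ⊆ s.U n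

/-- The underlying set of the end compactification. -/
inductive EndCompactification : Type _
  | point (x : M.Point) : EndCompactification
  | topEnd (γ : M.TopEnd) : EndCompactification

/-- The extension `Û` of a set `U` of points: add all ends that are represented by a sequence
with first member inside `U`. -/
def hat (U : Set M.Point) : Set M.EndCompactification :=
  EndCompactification.point '' U ∪
    EndCompactification.topEnd '' {γ | ∃ s : M.EndSeq, s.Represents γ ∧ s.U 0 ⊆ U}

/-- The topology of the end compactification, with basis `Û`, `U` open. -/
noncomputable instance : TopologicalSpace M.EndCompactification :=
  TopologicalSpace.generateFrom {W | ∃ U : Set M.Point, IsOpen U ∧ W = M.hat U}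

/-! ### The Sobolev space -/

/-- The component `f_e` of `f` on the edge `e ≅ [0, |e|]`. -/
noncomputable def onEdge {M : MetricGraph V} (f : M.Point → ℂ) (e : M.graph.edgeSet) : ℝ → ℂ :=
  fun t => f (M.edgePt e t)

/-- `‖f‖²` in `L²`, with values in `[0, ∞]`. -/
noncomputable def sqNormL2 {M : MetricGraph V} (f : M.Point → ℂ) : ℝ≥0∞ :=
  ∑' e : M.graph.edgeSet, ∫⁻ t in Set.Ioo 0 (M.len e), ‖onEdge f e t‖ₑ ^ 2

/-- `‖f'‖²` in `L²`, with values in `[0, ∞]`, for `f` absolutely continuous on every edge. -/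
noncomputable def energy {M : MetricGraph V} (f : M.Point → ℂ) : ℝ≥0∞ :=
  ∑' e : M.graph.edgeSet, ∫⁻ t in Set.Ioo 0 (M.len e), ‖deriv (onEdge f e) t‖ₑ ^ 2

/-- Membership in `H¹`: a continuous square integrable function that lies in `H¹(e)` for every
edge `e` (absolutely continuous with square integrable derivative) and has finite energy. -/
structure MemH1 {M : MetricGraph V} (f : M.Point → ℂ) : Prop where
  continuous : Continuous f
  sqNormL2_lt_top : sqNormL2 f < ∞
  absolutelyContinuous : ∀ e, AbsolutelyContinuousOnInterval (onEdge f e) 0 (M.len e)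
  memLp_deriv : ∀ e, MemLp (deriv (onEdge f e)) 2 (volume.restrict (Set.Ioo 0 (M.len e)))
  energy_lt_top : energy f < ∞

/-- The norm of `H¹`. -/
noncomputable def normH1 {M : MetricGraph V} (f : M.Point → ℂ) : ℝ :=
  √(sqNormL2 f + energy f).toReal

/-! ### The constant -/

/-- The length of a walk (for a path without self-intersections: the total length of its edges). -/
noncomputable def walkLen {u v : V} (p : M.graph.Walk u v) : ℝ :=
  (p.darts.map fun d => M.len ⟨d.edge, d.edge_mem⟩).sum

/-- The diameter: the supremum, in `[0, ∞]`, of the lengths of all (finite) paths without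
self-intersections. -/
noncomputable def diam : ℝ≥0∞ :=
  ⨆ (u : V) (v : V) (p : M.graph.Path u v), ENNReal.ofReal (M.walkLen p.1)

open Classical in
/-- The constant `√(coth (diam / 2))`, where `coth ∞ = 1`. -/
noncomputable def sobolevConst : ℝ :=
  if M.diam = ∞ then 1
  else √(Real.cosh (M.diam.toReal / 2) / Real.sinh (M.diam.toReal / 2))

end MetricGraph

/-!
If `h'' = h`, then `(2 ⟪g, h'⟫ - ⟪h, h'⟫)' = ‖g‖² + ‖g'‖² - ‖g - h‖² - ‖g' - h'‖²`, so a curve `g`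
on an arc has energy `∫ ‖g‖² + ‖g'‖²` at least the increment of `2 ⟪g, h'⟫ - ⟪h, h'⟫`, and such
increments add up along walks. Choosing `h` suitably, an arc of length `ℓ` from `x` to `y` has
energy at least `tanh ℓ * ‖x‖²` and at least `‖y - x‖² / 2`.

Any trail of length `D` and any point `x` admit a trail that starts at `x` and has length at least
`D / 2`: walk to the first contact with the given trail and follow its longer part. The first
estimate along it gives the bound with `coth (diam / 2)`.

By the second estimate `f` oscillates little on connected sets avoiding a suitable finite set of
edges. The members of a sequence defining an end are eventually of this kind, as are the tails of
a ray, so `f` is Cauchy along both; since the graph is dense in its end compactification, `f`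
extends by continuity.
-/

/-! ### Calibrations -/

section Calibration

variable {E : Type*} [NormedAddCommGroup E] [InnerProductSpace ℝ E]

open scoped RealInnerProductSpace

/-- A pair `(h, h')` with `h'' = h`, i.e. a solution of the Euler-Lagrange equation of the energy
`∫ ‖g‖² + ‖g'‖²`. Testing a curve against all such solutions bounds its energy from below. -/
structure IsCalibration (h k : ℝ → E) : Prop where
  hasDerivAt_fst : ∀ t, HasDerivAt h (k t) t
  hasDerivAt_snd : ∀ t, HasDerivAt k (h t) t

/-- The boundary term of the calibration argument: along a curve `g`, the derivative of
`calibrationFlux (g t) (h t) (h' t)` is at most `‖g‖² + ‖g'‖²`, as the difference is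
`‖g - h‖² + ‖g' - h'‖²`. -/
def calibrationFlux (x h k : E) : ℝ := 2 * ⟪x, k⟫ - ⟪h, k⟫

/-- `ArcEnergyLE x y ℓ ε` says that the energy `ε` is compatible, for every calibration, with an arc
of length `ℓ` from `x` to `y`; this relation composes along concatenation of arcs. -/
def ArcEnergyLE (x y : E) (ℓ ε : ℝ) : Prop :=
  ∀ ⦃h k : ℝ → E⦄, IsCalibration h k →
    calibrationFlux y (h ℓ) (k ℓ) - calibrationFlux x (h 0) (k 0) ≤ ε

namespace IsCalibration

variable {h k : ℝ → E}

theorem comp_add_const (hk : IsCalibration h k) (a : ℝ) :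
    IsCalibration (fun t => h (t + a)) (fun t => k (t + a)) where
  hasDerivAt_fst t := (hk.hasDerivAt_fst (t + a)).comp_add_const t a
  hasDerivAt_snd t := (hk.hasDerivAt_snd (t + a)).comp_add_const t a

theorem comp_const_sub (hk : IsCalibration h k) (a : ℝ) :
    IsCalibration (fun t => h (a - t)) (fun t => -k (a - t)) where
  hasDerivAt_fst t := (hk.hasDerivAt_fst (a - t)).comp_const_sub a t
  hasDerivAt_snd t := by simpa using! ((hk.hasDerivAt_snd (a - t)).comp_const_sub a t).neg

theorem sinh_cosh (ξ : E) :
    IsCalibration (fun t => Real.sinh t • ξ) (fun t => Real.cosh t • ξ) where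
  hasDerivAt_fst t := (Real.hasDerivAt_sinh t).smul_const ξ
  hasDerivAt_snd t := (Real.hasDerivAt_cosh t).smul_const ξ

theorem cosh_sinh (ξ : E) :
    IsCalibration (fun t => Real.cosh t • ξ) (fun t => Real.sinh t • ξ) where
  hasDerivAt_fst t := (Real.hasDerivAt_cosh t).smul_const ξ
  hasDerivAt_snd t := (Real.hasDerivAt_sinh t).smul_const ξ

theorem contDiff_one (hk : IsCalibration h k) : ContDiff ℝ 1 h ∧ ContDiff ℝ 1 k := by
  have deriv_h : deriv h = k := funext fun t => (hk.hasDerivAt_fst t).deriv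
  have deriv_k : deriv k = h := funext fun t => (hk.hasDerivAt_snd t).deriv
  have diff_h : Differentiable ℝ h := fun t => (hk.hasDerivAt_fst t).differentiableAt
  have diff_k : Differentiable ℝ k := fun t => (hk.hasDerivAt_snd t).differentiableAt
  exact ⟨contDiff_one_iff_deriv.2 ⟨diff_h, deriv_h ▸ diff_k.continuous⟩,
    contDiff_one_iff_deriv.2 ⟨diff_k, deriv_k ▸ diff_h.continuous⟩⟩

end IsCalibration

theorem calibrationFlux_neg (x h k : E) : calibrationFlux x h (-k) = -calibrationFlux x h k := by
  simp only [calibrationFlux, inner_neg_right]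
  ring

namespace ArcEnergyLE

variable {x y z : E} {ℓ ℓ₁ ℓ₂ ε ε' ε₁ ε₂ : ℝ}

theorem refl (x : E) : ArcEnergyLE x x 0 0 := fun _ _ _ => (sub_self _).le

theorem mono (H : ArcEnergyLE x y ℓ ε) (hε : ε ≤ ε') : ArcEnergyLE x y ℓ ε' :=
  fun _ _ hk => (H hk).trans hε

theorem trans (H₁ : ArcEnergyLE x y ℓ₁ ε₁) (H₂ : ArcEnergyLE y z ℓ₂ ε₂) :
    ArcEnergyLE x z (ℓ₁ + ℓ₂) (ε₁ + ε₂) := by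
  intro h k hk
  have h₁ := H₁ hk
  have h₂ := H₂ (hk.comp_add_const ℓ₁)
  simp only [zero_add, add_comm ℓ₂] at h₂
  linarith

theorem symm (H : ArcEnergyLE x y ℓ ε) : ArcEnergyLE y x ℓ ε := by
  intro h k hk
  have h₁ := H (hk.comp_const_sub ℓ)
  simp only [sub_self, sub_zero, calibrationFlux_neg] at h₁
  linarith

/-- Calibrate with the multiple of `cosh (ℓ - t)` equal to `x` at `t = 0`. -/
theorem tanh_mul_sq_norm_le (H : ArcEnergyLE x y ℓ ε) : Real.tanh ℓ * ‖x‖ ^ 2 ≤ ε := by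
  have h₁ := H ((IsCalibration.cosh_sinh ((Real.cosh ℓ)⁻¹ • x)).comp_const_sub ℓ)
  have hcosh := (Real.cosh_pos ℓ).ne'
  simp only [calibrationFlux, sub_self, sub_zero, Real.cosh_zero, Real.sinh_zero, zero_smul,
    neg_zero, inner_zero_right, inner_neg_right, real_inner_smul_left, real_inner_smul_right,
    real_inner_self_eq_norm_sq] at h₁
  rw [Real.tanh_eq_sinh_div_cosh]
  refine le_of_eq_of_le ?_ h₁
  field_simp
  ring

/-- Calibrate with a multiple of `sinh (t - ℓ / 2)`. -/
theorem sq_norm_sub_le (H : ArcEnergyLE x y ℓ ε) : ‖y - x‖ ^ 2 ≤ 2 * ε := by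
  set c := Real.cosh (ℓ / 2)
  set s := Real.sinh (ℓ / 2)
  have c_pos : 0 < c := Real.cosh_pos _
  have s_div_c_le : s / c ≤ 1 := (div_le_one c_pos).2 (Real.sinh_lt_cosh _).le
  set ξ := (2 * c)⁻¹ • (y - x) with ξ_def
  have flux_le : calibrationFlux y (s • ξ) (c • ξ) - calibrationFlux x (-s • ξ) (c • ξ) ≤ ε := by
    simpa [c, s, add_neg_eq_iff_eq_add.2 (add_halves ℓ).symm] using
      H ((IsCalibration.sinh_cosh ξ).comp_add_const (-(ℓ / 2)))
  have flux_eq : calibrationFlux y (s • ξ) (c • ξ) - calibrationFlux x (-s • ξ) (c • ξ) =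
      2 * c * ⟪y - x, ξ⟫ - 2 * s * c * ‖ξ‖ ^ 2 := by
    simp only [calibrationFlux, inner_sub_left, real_inner_smul_left, real_inner_smul_right,
      real_inner_self_eq_norm_sq]
    ring
  have inner_eq : 2 * c * ⟪y - x, ξ⟫ - 2 * s * c * ‖ξ‖ ^ 2 = (1 - s / c / 2) * ‖y - x‖ ^ 2 := by
    rw [ξ_def, real_inner_smul_right, real_inner_self_eq_norm_sq, norm_smul, mul_pow,
      Real.norm_eq_abs, sq_abs]
    field_simp
  nlinarith [sq_nonneg ‖y - x‖]

end ArcEnergyLE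

theorem absolutelyContinuousOnInterval_norm {F : Type*} [SeminormedAddCommGroup F] {g : ℝ → F}
    {a b : ℝ} (hg : AbsolutelyContinuousOnInterval g a b) :
    AbsolutelyContinuousOnInterval (fun t => ‖g t‖) a b :=
  squeeze_zero (fun _ => Finset.sum_nonneg fun _ _ => dist_nonneg)
    (fun _ => Finset.sum_le_sum fun _ _ =>
      (dist_norm_norm_le _ _).trans_eq (dist_eq_norm _ _).symm) hg

theorem absolutelyContinuousOnInterval_inner {g k : ℝ → E} {a b : ℝ}
    (hg : AbsolutelyContinuousOnInterval g a b) (hk : AbsolutelyContinuousOnInterval k a b) :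
    AbsolutelyContinuousOnInterval (fun t => ⟪g t, k t⟫) a b := by
  have sq_norm {u : ℝ → E} (hu : AbsolutelyContinuousOnInterval u a b) :
      AbsolutelyContinuousOnInterval (fun t => ‖u t‖ * ‖u t‖) a b :=
    (absolutelyContinuousOnInterval_norm hu).fun_mul (absolutelyContinuousOnInterval_norm hu)
  simp only [real_inner_eq_norm_add_mul_self_sub_norm_mul_self_sub_norm_mul_self_div_two,
    div_eq_inv_mul]
  exact (((sq_norm (hg.fun_add hk)).fun_sub (sq_norm hg)).fun_sub (sq_norm hk)).const_mul _

theorem IsCalibration.deriv_flux_le {h k : ℝ → E} (hk : IsCalibration h k) {g : ℝ → E}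
    {g' : E} {t : ℝ} (hg : HasDerivAt g g' t) :
    deriv (fun t => calibrationFlux (g t) (h t) (k t)) t ≤ ‖g t‖ ^ 2 + ‖g'‖ ^ 2 := by
  have hasDerivAt := ((hg.inner ℝ (hk.hasDerivAt_snd t)).const_mul 2).sub
    ((hk.hasDerivAt_fst t).inner ℝ (hk.hasDerivAt_snd t))
  refine le_of_eq_of_le hasDerivAt.deriv ?_
  have h₁ := sq_nonneg ‖g t - h t‖
  have h₂ := sq_nonneg ‖g' - k t‖
  rw [norm_sub_sq_real] at h₁ h₂
  simp only [real_inner_self_eq_norm_sq]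
  linarith

theorem arcEnergyLE_of_absolutelyContinuousOnInterval [FiniteDimensional ℝ E] {g : ℝ → E} {a b : ℝ}
    (hab : a ≤ b) (hg : AbsolutelyContinuousOnInterval g a b)
    (hg' : IntervalIntegrable (fun t => ‖deriv g t‖ ^ 2) volume a b) :
    ArcEnergyLE (g a) (g b) (b - a) (∫ t in a..b, (‖g t‖ ^ 2 + ‖deriv g t‖ ^ 2)) := by
  intro h₀ k₀ hk₀
  set h := fun t => h₀ (t + -a)
  set k := fun t => k₀ (t + -a)
  have hk : IsCalibration h k := hk₀.comp_add_const (-a)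
  set φ := fun t => calibrationFlux (g t) (h t) (k t) with φ_def
  have hAC := hk.contDiff_one.1.contDiffOn.absolutelyContinuousOnInterval (a := a) (b := b)
  have kAC := hk.contDiff_one.2.contDiffOn.absolutelyContinuousOnInterval (a := a) (b := b)
  have φAC : AbsolutelyContinuousOnInterval φ a b :=
    ((absolutelyContinuousOnInterval_inner hg kAC).const_mul 2).fun_sub
      (absolutelyContinuousOnInterval_inner hAC kAC)
  have g_sq : IntervalIntegrable (fun t => ‖g t‖ ^ 2) volume a b :=
    (hg.continuousOn.norm.pow 2).intervalIntegrable
  have deriv_φ_le : ∀ᵐ t ∂volume.restrict (Set.Icc a b),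
      deriv φ t ≤ ‖g t‖ ^ 2 + ‖deriv g t‖ ^ 2 := by
    rw [ae_restrict_iff' measurableSet_Icc, ← Set.uIcc_of_le hab]
    filter_upwards [hg.boundedVariationOn.ae_differentiableAt_of_mem_uIcc] with t ht hmem
    exact hk.deriv_flux_le (ht hmem).hasDerivAt
  have ftc : φ b - φ a ≤ ∫ t in a..b, (‖g t‖ ^ 2 + ‖deriv g t‖ ^ 2) :=
    φAC.integral_deriv_eq_sub ▸ intervalIntegral.integral_mono_ae_restrict hab
      φAC.intervalIntegrable_deriv (g_sq.add hg') deriv_φ_le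
  simpa [φ_def, h, k, sub_eq_add_neg] using ftc

end Calibration

/-! ### Trails with a prescribed starting point -/

section WalkSum

open SimpleGraph

variable {V : Type*} {G : SimpleGraph V} {a b u v w : V}

/-- The sum of the weights `φ` over the edges of a walk, counted with multiplicity. -/
def walkSum (φ : Sym2 V → ℝ) (p : G.Walk u v) : ℝ := (p.edges.map φ).sum

variable (φ : Sym2 V → ℝ)

@[simp] theorem walkSum_cons (h : G.Adj u v) (p : G.Walk v w) :
    walkSum φ (.cons h p) = φ s(u, v) + walkSum φ p := by
  simp [walkSum]

@[simp] theorem walkSum_append (p : G.Walk u v) (q : G.Walk v w) :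
    walkSum φ (p.append q) = walkSum φ p + walkSum φ q := by
  simp [walkSum]

@[simp] theorem walkSum_reverse (p : G.Walk u v) : walkSum φ p.reverse = walkSum φ p := by
  simp [walkSum, List.sum_reverse]

variable {φ}

theorem walkSum_nonneg (hφ : ∀ e, 0 ≤ φ e) (p : G.Walk u v) : 0 ≤ walkSum φ p :=
  List.sum_nonneg (by simpa using fun e _ => hφ e)

theorem exists_isPath_first_hit (r : G.Walk a u) {S : Set V} (hu : u ∈ S) :
    ∃ c ∈ S, ∃ q : G.Walk a c, q.IsPath ∧ ∀ x ∈ q.support, x ∈ S → x = c := by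
  classical
  suffices H : ∃ c ∈ S, ∃ q : G.Walk a c, ∀ x ∈ q.support, x ∈ S → x = c by
    obtain ⟨c, hc, q, hq⟩ := H
    exact ⟨c, hc, q.bypass, q.bypass_isPath, fun x hx => hq x (q.support_bypass_subset_support hx)⟩
  induction r with
  | nil => exact ⟨_, hu, .nil, by simp⟩
  | @cons a _ _ h _ ih =>
    by_cases ha : a ∈ S
    · exact ⟨a, ha, .nil, by simp⟩
    · obtain ⟨c, hc, q, hq⟩ := ih hu
      refine ⟨c, hc, .cons h q, fun x hx hxS => ?_⟩
      rcases List.mem_cons.1 (Walk.support_cons h q ▸ hx) with rfl | hx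
      · exact absurd hxS ha
      · exact hq x hx hxS

theorem disjoint_edges_of_inter_support {c : V} {q : G.Walk a c} {p : G.Walk u v}
    (h : ∀ x ∈ q.support, x ∈ p.support → x = c) : q.edges.Disjoint p.edges := by
  rintro ⟨x, y⟩ hq hp
  have hx := h x (q.fst_mem_support_of_mem_edges hq) (p.fst_mem_support_of_mem_edges hp)
  have hy := h y (q.snd_mem_support_of_mem_edges hq) (p.snd_mem_support_of_mem_edges hp)
  exact (q.adj_of_mem_edges hq).ne (hx.trans hy.symm)

theorem exists_isTrail_half (φ : Sym2 V → ℝ) {p : G.Walk u v} (hp : p.IsTrail) {c : V}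
    (hc : c ∈ p.support) : ∃ w, ∃ q : G.Walk c w,
      q.IsTrail ∧ q.edges ⊆ p.edges ∧ walkSum φ p ≤ 2 * walkSum φ q := by
  classical
  have sum_eq : walkSum φ p = walkSum φ (p.takeUntil c hc) + walkSum φ (p.dropUntil c hc) := by
    rw [← walkSum_append, p.take_spec]
  rcases le_total (walkSum φ (p.takeUntil c hc)) (walkSum φ (p.dropUntil c hc)) with h | h
  · exact ⟨v, p.dropUntil c hc, hp.dropUntil hc, p.edges_dropUntil_subset_edges hc, by linarith⟩
  · refine ⟨u, (p.takeUntil c hc).reverse, (hp.takeUntil hc).reverse, ?_, ?_⟩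
    · simpa using p.edges_takeUntil_subset_edges hc
    · rw [walkSum_reverse]
      linarith

/-- Follow `q` to its first contact with the trail `p`, then the longer part of `p`. -/
theorem exists_isTrail_of_first_hit (hφ : ∀ e, 0 ≤ φ e) {p : G.Walk u v} (hp : p.IsTrail) {c : V}
    {q : G.Walk a c} (hq : q.IsTrail) (hc : c ∈ p.support) (hqp : q.edges.Disjoint p.edges) :
    ∃ w, ∃ r : G.Walk a w,
      r.IsTrail ∧ r.edges ⊆ q.edges ++ p.edges ∧ walkSum φ p ≤ 2 * walkSum φ r := by
  obtain ⟨w, r, hr, hrp, hle⟩ := exists_isTrail_half φ hp hc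
  refine ⟨w, q.append r, (q.isTrail_append r).2 ⟨hq, hr, List.disjoint_of_subset_right hrp hqp⟩,
    ?_, ?_⟩
  · rw [Walk.edges_append]
    exact List.append_subset.2
      ⟨List.subset_append_left _ _, fun _ he => List.mem_append_right _ (hrp he)⟩
  · rw [walkSum_append]
    linarith [walkSum_nonneg hφ q]

theorem exists_isTrail_from (hG : G.Connected) (hφ : ∀ e, 0 ≤ φ e) {p : G.Walk u v}
    (hp : p.IsTrail) (a : V) :
    ∃ w, ∃ q : G.Walk a w, q.IsTrail ∧ walkSum φ p ≤ 2 * walkSum φ q := by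
  obtain ⟨r⟩ := hG.preconnected a u
  obtain ⟨c, hc, q, hq, hqp⟩ := exists_isPath_first_hit r (S := {x | x ∈ p.support})
    p.start_mem_support
  obtain ⟨w, r, hr, -, hle⟩ := exists_isTrail_of_first_hit hφ hp hq.isTrail hc
    (disjoint_edges_of_inter_support hqp)
  exact ⟨w, r, hr, hle⟩

/-- A path from `a` can use an edge at `a` only as its first edge. -/
theorem exists_isPath_tail {c : V} {q : G.Walk a c} (hq : q.IsPath) (h : s(a, b) ∈ q.edges) :
    ∃ q' : G.Walk b c, q'.IsPath ∧ s(a, b) ∉ q'.edges ∧ q'.edges ⊆ q.edges := by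
  cases q with
  | nil => simp at h
  | cons hadj q =>
    obtain ⟨hq, ha⟩ := (Walk.cons_isPath_iff hadj q).1 hq
    have notMem (x : V) : s(a, x) ∉ q.edges := fun hx => ha (q.fst_mem_support_of_mem_edges hx)
    rcases List.mem_cons.1 (Walk.edges_cons hadj q ▸ h) with h | h
    · obtain rfl := Sym2.congr_right.1 h
      exact ⟨q, hq, notMem _, by simp⟩
    · exact absurd h (notMem b)

theorem exists_isTrail_avoiding (hG : G.Connected) (hφ : ∀ e, 0 ≤ φ e) {p : G.Walk u v}
    (hp : p.IsTrail) (hab : s(a, b) ∉ p.edges) :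
    ∃ c ∈ ({a, b} : Set V), ∃ w, ∃ q : G.Walk c w,
      q.IsTrail ∧ s(a, b) ∉ q.edges ∧ walkSum φ p ≤ 2 * walkSum φ q := by
  obtain ⟨r⟩ := hG.preconnected a u
  obtain ⟨c, hc, q, hq, hqp⟩ := exists_isPath_first_hit r (S := {x | x ∈ p.support})
    p.start_mem_support
  have disj := disjoint_edges_of_inter_support hqp
  suffices H : ∃ d ∈ ({a, b} : Set V), ∃ q' : G.Walk d c,
      q'.IsPath ∧ s(a, b) ∉ q'.edges ∧ q'.edges ⊆ q.edges by
    obtain ⟨d, hd, q', hq', hnot, hsub⟩ := H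
    obtain ⟨w, r, hr, hrsub, hle⟩ := exists_isTrail_of_first_hit hφ hp hq'.isTrail hc
      (List.disjoint_of_subset_left hsub disj)
    exact ⟨d, hd, w, r, hr, fun h => (List.mem_append.1 (hrsub h)).elim hnot hab, hle⟩
  by_cases h : s(a, b) ∈ q.edges
  · exact ⟨b, by simp, exists_isPath_tail hq h⟩
  · exact ⟨a, by simp, q, hq, h, fun _ => id⟩

theorem exists_walks_perm_edges {p : G.Walk u v} (h : s(a, b) ∈ p.edges) :
    ∃ x y, ∃ (q₁ : G.Walk a x) (q₂ : G.Walk b y),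
      p.edges.Perm (s(a, b) :: (q₁.edges ++ q₂.edges)) := by
  suffices H : ∃ c d, s(c, d) = s(a, b) ∧ ∃ (p₁ : G.Walk u c) (p₂ : G.Walk d v),
      p.edges = p₁.edges ++ s(a, b) :: p₂.edges by
    obtain ⟨c, d, hcd, p₁, p₂, hp⟩ := H
    have perm : p.edges.Perm (s(a, b) :: (p₁.reverse.edges ++ p₂.edges)) := by
      rw [hp, Walk.edges_reverse]
      exact List.perm_middle.trans (((List.reverse_perm _).symm.append_right _).cons _)
    rcases Sym2.eq_iff.1 hcd with ⟨rfl, rfl⟩ | ⟨rfl, rfl⟩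
    · exact ⟨u, v, p₁.reverse, p₂, perm⟩
    · exact ⟨v, u, p₂, p₁.reverse, perm.trans (List.perm_append_comm.cons _)⟩
  induction p with
  | nil => simp at h
  | @cons u u' v hadj p ih =>
    rcases List.mem_cons.1 (Walk.edges_cons hadj p ▸ h) with h | h
    · exact ⟨u, u', h.symm, .nil, p, by simp [h]⟩
    · obtain ⟨c, d, hcd, p₁, p₂, hp⟩ := ih h
      exact ⟨c, d, hcd, .cons hadj p₁, p₂, by simp [hp]⟩

/-- From a point dividing the edge `s(a, b)` into parts of lengths `la` and `lb`, one can leave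
through `a` or through `b` along a trail at least half as long as a given trail `p`. -/
theorem exists_isTrail_from_edge (hG : G.Connected) (hφ : ∀ e, 0 ≤ φ e) {la lb : ℝ} (hla : 0 ≤ la)
    (hlb : 0 ≤ lb) (hadd : la + lb = φ s(a, b)) {p : G.Walk u v} (hp : p.IsTrail) :
    (∃ w, ∃ q : G.Walk a w,
      q.IsTrail ∧ s(a, b) ∉ q.edges ∧ walkSum φ p ≤ 2 * (la + walkSum φ q)) ∨
    ∃ w, ∃ q : G.Walk b w,
      q.IsTrail ∧ s(a, b) ∉ q.edges ∧ walkSum φ p ≤ 2 * (lb + walkSum φ q) := by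
  by_cases hab : s(a, b) ∈ p.edges
  · obtain ⟨x, y, q₁, q₂, perm⟩ := exists_walks_perm_edges hab
    have sum_eq : walkSum φ p = φ s(a, b) + (walkSum φ q₁ + walkSum φ q₂) := by
      simp only [walkSum, (perm.map φ).sum_eq, List.map_cons, List.map_append, List.sum_cons,
        List.sum_append]
    have nodup := perm.nodup_iff.1 hp.edges_nodup
    rw [List.nodup_cons, List.mem_append, not_or, List.nodup_append] at nodup
    obtain ⟨⟨h₁, h₂⟩, nodup₁, nodup₂, -⟩ := nodup
    rcases le_total (la + walkSum φ q₁) (lb + walkSum φ q₂) with h | h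
    · exact .inr ⟨y, q₂, ⟨nodup₂⟩, h₂, by linarith⟩
    · exact .inl ⟨x, q₁, ⟨nodup₁⟩, h₁, by linarith⟩
  · obtain ⟨c, rfl | rfl, w, q, hq, hnot, hle⟩ := exists_isTrail_avoiding hG hφ hp hab
    · exact .inl ⟨w, q, hq, hnot, by linarith⟩
    · exact .inr ⟨w, q, hq, hnot, by linarith⟩

end WalkSum

/-! ### Topology of a metric graph -/

namespace MetricGraph

open SimpleGraph Set

variable {V : Type*} {M : MetricGraph V}

theorem mem_edge_iff {e : M.graph.edgeSet} {v : V} : v ∈ e.1 ↔ v = M.src e ∨ v = M.tgt e := by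
  rw [← M.ends e, Sym2.mem_iff]

theorem edgePt_of_nonpos {e : M.graph.edgeSet} {t : ℝ} (h : t ≤ 0) :
    M.edgePt e t = .vertex (M.src e) := by
  simp [edgePt, h]

theorem edgePt_of_len_le {e : M.graph.edgeSet} {t : ℝ} (h : M.len e ≤ t) :
    M.edgePt e t = .vertex (M.tgt e) := by
  have : ¬ t ≤ 0 := not_le.2 ((M.len_pos e).trans_le h)
  simp [edgePt, h, this]

theorem edgePt_of_mem_Ioo {e : M.graph.edgeSet} {t : ℝ} (h : t ∈ Ioo 0 (M.len e)) :
    M.edgePt e t = .inner e ⟨t, h⟩ := by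
  simp [edgePt, not_le.2 h.1, not_le.2 h.2]

theorem edgePt_cases (e : M.graph.edgeSet) (t : ℝ) :
    M.edgePt e t = .vertex (M.src e) ∨ M.edgePt e t = .vertex (M.tgt e) ∨
      ∃ s, M.edgePt e t = .inner e s := by
  rcases le_or_gt t 0 with h₀ | h₀
  · exact .inl (edgePt_of_nonpos h₀)
  rcases le_or_gt (M.len e) t with h₁ | h₁
  · exact .inr (.inl (edgePt_of_len_le h₁))
  · exact .inr (.inr ⟨_, edgePt_of_mem_Ioo ⟨h₀, h₁⟩⟩)

theorem eq_of_edgePt_eq_inner {e e' : M.graph.edgeSet} {s : ℝ} {t : Ioo 0 (M.len e')}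
    (h : M.edgePt e s = .inner e' t) : e = e' ∧ s = t := by
  rcases le_or_gt s 0 with h₀ | h₀
  · exact nomatch (edgePt_of_nonpos h₀).symm.trans h
  rcases le_or_gt (M.len e) s with h₁ | h₁
  · exact nomatch (edgePt_of_len_le h₁).symm.trans h
  · cases (edgePt_of_mem_Ioo ⟨h₀, h₁⟩).symm.trans h
    exact ⟨rfl, rfl⟩

/-- The closed edge `e`, as a subset of the metric graph. -/
def closedEdge (M : MetricGraph V) (e : M.graph.edgeSet) : Set M.Point :=
  M.edgePt e '' Icc 0 (M.len e)

theorem edgePt_mem_closedEdge (e : M.graph.edgeSet) (t : ℝ) : M.edgePt e t ∈ M.closedEdge e := by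
  have h₀ := (M.len_pos e).le
  rcases le_total t 0 with h | h
  · exact ⟨0, ⟨le_rfl, h₀⟩, by rw [edgePt_of_nonpos h, edgePt_of_nonpos le_rfl]⟩
  rcases le_total (M.len e) t with h' | h'
  · exact ⟨M.len e, ⟨h₀, le_rfl⟩, by rw [edgePt_of_len_le h', edgePt_of_len_le le_rfl]⟩
  · exact ⟨t, ⟨h, h'⟩, rfl⟩

theorem inner_mem_closedEdge_iff {e e' : M.graph.edgeSet} {t : Ioo (0 : ℝ) (M.len e')} :
    .inner e' t ∈ M.closedEdge e ↔ e' = e := by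
  constructor
  · rintro ⟨s, -, hs⟩
    exact (eq_of_edgePt_eq_inner hs).1.symm
  · rintro rfl
    simpa only [edgePt_of_mem_Ioo t.2] using edgePt_mem_closedEdge e' t.1

theorem vertex_mem_closedEdge_iff {e : M.graph.edgeSet} {v : V} :
    .vertex v ∈ M.closedEdge e ↔ v ∈ e.1 := by
  rw [mem_edge_iff]
  constructor
  · rintro ⟨s, -, hs⟩
    rcases edgePt_cases e s with h | h | ⟨s', h⟩ <;> cases h.symm.trans hs
    · exact .inl rfl
    · exact .inr rfl
  · rintro (rfl | rfl)
    · exact edgePt_of_nonpos (e := e) le_rfl ▸ edgePt_mem_closedEdge e 0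
    · exact edgePt_of_len_le (e := e) le_rfl ▸ edgePt_mem_closedEdge e (M.len e)

theorem isOpen_iff {U : Set M.Point} :
    IsOpen U ↔ ∀ e, IsOpen ((fun t : Icc 0 (M.len e) => M.edgePt e t) ⁻¹' U) := by
  simp only [isOpen_iSup_iff, isOpen_coinduced]

theorem isClosed_iff {S : Set M.Point} :
    IsClosed S ↔ ∀ e, IsClosed ((fun t : Icc 0 (M.len e) => M.edgePt e t) ⁻¹' S) := by
  simp only [← isOpen_compl_iff, isOpen_iff, preimage_compl]

theorem continuous_edgePt (e : M.graph.edgeSet) : Continuous (M.edgePt e) := by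
  have h₀ := (M.len_pos e).le
  have on_Icc : Continuous fun t : Icc 0 (M.len e) => M.edgePt e t :=
    continuous_def.2 fun U hU => isOpen_iff.1 hU e
  convert on_Icc.comp (continuous_projIcc (h := h₀)) using 1
  funext t
  rcases le_total t 0 with h | h
  · simp [projIcc_of_le_left _ h, edgePt_of_nonpos h, edgePt_of_nonpos le_rfl]
  rcases le_total (M.len e) t with h' | h'
  · simp [projIcc_of_right_le _ h', edgePt_of_len_le h', edgePt_of_len_le le_rfl]
  · simp [projIcc_of_mem h₀ ⟨h, h'⟩]

theorem isCompact_closedEdge (e : M.graph.edgeSet) : IsCompact (M.closedEdge e) :=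
  isCompact_Icc.image (continuous_edgePt e)

theorem isPreconnected_closedEdge (e : M.graph.edgeSet) : IsPreconnected (M.closedEdge e) :=
  isPreconnected_Icc.image _ (continuous_edgePt e).continuousOn

/-- The predicate `P` and its negation both cut out open subsets of `U`. -/
theorem isPreconnected_induction {U : Set M.Point} (hU : IsOpen U) (hU' : IsPreconnected U)
    {P : M.Point → Prop}
    (hP : ∀ e s t, M.edgePt e s ∈ U → M.edgePt e t ∈ U → P (M.edgePt e s) → P (M.edgePt e t))
    {x y : M.Point} (hx : x ∈ U) (hy : y ∈ U) (hPx : P x) : P y := by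
  have isOpen_sep {Q : M.Point → Prop} (hQ : ∀ e s t, M.edgePt e s ∈ U → M.edgePt e t ∈ U →
      Q (M.edgePt e s) → Q (M.edgePt e t)) : IsOpen {x ∈ U | Q x} := by
    refine isOpen_iff.2 fun e => ?_
    by_cases h : ∃ s, M.edgePt e s ∈ U ∧ Q (M.edgePt e s)
    · obtain ⟨s, hsU, hs⟩ := h
      convert isOpen_iff.1 hU e using 1
      ext t
      exact ⟨fun ht => ht.1, fun ht => ⟨ht, hQ e s t hsU ht hs⟩⟩
    · convert isOpen_empty
      exact eq_empty_iff_forall_notMem.2 fun t ht => h ⟨t, ht⟩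
  have sub := hU'.subset_left_of_subset_union (isOpen_sep hP)
    (isOpen_sep (Q := (¬P ·)) fun e s t hs ht hPs hPt => hPs (hP e t s ht hs hPt))
    (Set.disjoint_left.2 fun _ hz hz' => hz'.2 hz.2)
    (fun z hz => (em (P z)).imp (⟨hz, ·⟩) (⟨hz, ·⟩)) ⟨x, hx, hx, hPx⟩
  exact (sub hy).2

theorem exists_subset_closedEdge {U : Set M.Point} (hU : IsOpen U) (hU' : IsConnected U)
    (hV : ∀ v, .vertex v ∉ U) : ∃ e, U ⊆ M.closedEdge e := by
  obtain ⟨x, hx⟩ := hU'.nonempty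
  cases x with
  | vertex v => exact absurd hx (hV v)
  | inner e t =>
    refine ⟨e, fun y hy => isPreconnected_induction hU hU'.isPreconnected
      (P := (· ∈ M.closedEdge e)) (fun e' s t hs _ hse => ?_) hx hy
      (inner_mem_closedEdge_iff.2 rfl)⟩
    rcases edgePt_cases e' s with h | h | ⟨s', h⟩ <;> rw [h] at hs hse
    · exact absurd hs (hV _)
    · exact absurd hs (hV _)
    · exact inner_mem_closedEdge_iff.1 hse ▸ edgePt_mem_closedEdge e' t

/-- The open star of a vertex `v`: the vertex `v` and the open edges at `v`. -/
def openStar (M : MetricGraph V) (v : V) : Set M.Point :=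
  {x | x = .vertex v ∨ ∃ e t, x = .inner e t ∧ v ∈ e.1}

theorem exists_walk_mem_openStar {U : Set M.Point} (hU : IsOpen U) (hU' : IsPreconnected U) {v : V}
    (hv : .vertex v ∈ U) {x : M.Point} (hx : x ∈ U) :
    ∃ w, x ∈ M.openStar w ∧ ∃ p : M.graph.Walk v w, ∀ z ∈ p.support, .vertex z ∈ U := by
  let Joined (w : V) : Prop := ∃ p : M.graph.Walk v w, ∀ z ∈ p.support, Point.vertex z ∈ U
  have joined_of_adj {w w' : V} (h : M.graph.Adj w w') (hw' : Point.vertex w' ∈ U) :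
      Joined w → Joined w' := fun ⟨p, hp⟩ => ⟨p.concat h, fun z hz => by
    rw [Walk.support_concat, List.mem_append, List.mem_singleton] at hz
    rcases hz with hz | rfl
    exacts [hp z hz, hw']⟩
  refine isPreconnected_induction hU hU' (P := fun x => ∃ w, x ∈ M.openStar w ∧ Joined w)
    (fun e s t _ ht ⟨w, hsw, hw⟩ => ?_) hv hx ⟨v, .inl rfl, .nil, by simpa using hv⟩
  have hwe : w ∈ e.1 := by
    rcases hsw with h | ⟨e', t', h, hwe⟩
    · exact vertex_mem_closedEdge_iff.1 (h ▸ edgePt_mem_closedEdge e s)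
    · exact inner_mem_closedEdge_iff.1 (h ▸ edgePt_mem_closedEdge e s) ▸ hwe
  have joined_end {z : V} (hz : z ∈ e.1) (hzU : Point.vertex z ∈ U) : Joined z := by
    rcases eq_or_ne w z with rfl | hne
    · exact hw
    · refine joined_of_adj ?_ hzU hw
      rw [← mem_edgeSet, ← (Sym2.mem_and_mem_iff hne).1 ⟨hwe, hz⟩]
      exact e.2
  rcases edgePt_cases e t with h | h | ⟨t', h⟩ <;> rw [h] at ht ⊢
  · exact ⟨_, .inl rfl, joined_end (mem_edge_iff.2 (.inl rfl)) ht⟩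
  · exact ⟨_, .inl rfl, joined_end (mem_edge_iff.2 (.inr rfl)) ht⟩
  · exact ⟨w, .inr ⟨e, t', rfl, hwe⟩, hw⟩

theorem isClosed_of_finite_inter_closedEdge {S : Set M.Point}
    (hS : ∀ e, {t ∈ Icc 0 (M.len e) | M.edgePt e t ∈ S}.Finite) : IsClosed S :=
  isClosed_iff.2 fun e => (((hS e).preimage Subtype.val_injective.injOn).subset
    fun t ht => ⟨t.2, ht⟩).isClosed

theorem finite_of_finite_inter_closedEdge {S Q : Set M.Point} (hQ : IsCompact Q) (hSQ : S ⊆ Q)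
    (hS : ∀ e, {t ∈ Icc 0 (M.len e) | M.edgePt e t ∈ S}.Finite) : S.Finite := by
  have closed {T : Set M.Point} (hT : T ⊆ S) : IsClosed T :=
    isClosed_of_finite_inter_closedEdge fun e => (hS e).subset fun t ht => ⟨ht.1, hT ht.2⟩
  refine (hQ.of_isClosed_subset (closed subset_rfl) hSQ).finite ?_
  exact isDiscrete_iff_forall_mem_exists_isClosed.2 fun T hT =>
    ⟨T, closed hT, inter_eq_left.2 hT⟩

theorem finite_setOf_inner_mem {Q : Set M.Point} (hQ : IsCompact Q) :
    {e | ∃ t, Point.inner e t ∈ Q}.Finite := by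
  choose t ht using fun e : {e | ∃ t, Point.inner e t ∈ Q} => e.2
  let pick (e : {e | ∃ t, Point.inner e t ∈ Q}) : M.Point := .inner e (t e)
  have pick_injective : pick.Injective := fun e e' h => Subtype.ext (Point.inner.inj h).1
  have finite_range : (range pick).Finite :=
    finite_of_finite_inter_closedEdge hQ (range_subset_iff.2 ht) fun e =>
      Set.Subsingleton.finite fun s ⟨_, e₁, h₁⟩ s' ⟨_, e₂, h₂⟩ => by
        obtain ⟨he₁, hs⟩ := eq_of_edgePt_eq_inner h₁.symm
        obtain ⟨he₂, hs'⟩ := eq_of_edgePt_eq_inner h₂.symm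
        obtain rfl : e₁ = e₂ := Subtype.ext (he₁.symm.trans he₂)
        exact hs.trans hs'.symm
  simpa only [preimage_range, finite_univ_iff, finite_coe_iff] using
    finite_range.preimage pick_injective.injOn

end MetricGraph

/-! ### Energy along walks and the Sobolev inequality -/

namespace MetricGraph

open SimpleGraph Set

variable {V : Type*} {M : MetricGraph V}

/-- Extension by zero of a function on the edges to all unordered pairs of vertices, which makes it
a weight for `walkSum`. -/
noncomputable def extendEdges (M : MetricGraph V) (φ : M.graph.edgeSet → ℝ) : Sym2 V → ℝ :=
  Function.extend Subtype.val φ 0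

theorem extendEdges_val (φ : M.graph.edgeSet → ℝ) (e : M.graph.edgeSet) :
    M.extendEdges φ e.1 = φ e :=
  Subtype.val_injective.extend_apply _ _ _

theorem extendEdges_nonneg {φ : M.graph.edgeSet → ℝ} (hφ : ∀ e, 0 ≤ φ e) (e : Sym2 V) :
    0 ≤ M.extendEdges φ e := by
  by_cases h : e ∈ M.graph.edgeSet
  · exact (hφ ⟨e, h⟩).trans_eq (extendEdges_val φ ⟨e, h⟩).symm
  · rw [extendEdges, Function.extend_apply' _ _ _ fun ⟨e', he'⟩ => h (he' ▸ e'.2), Pi.zero_apply]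

theorem walkLen_eq {u v : V} (p : M.graph.Walk u v) :
    M.walkLen p = walkSum (M.extendEdges M.len) p := by
  rw [walkLen, walkSum, Walk.edges, List.map_map]
  exact congrArg _ (List.map_congr_left fun d _ =>
    (extendEdges_val M.len ⟨d.edge, d.edge_mem⟩).symm)

/-- The squared `H¹` norm of `f` on the edge `e`. -/
noncomputable def edgeEnergy (f : M.Point → ℂ) (e : M.graph.edgeSet) : ℝ :=
  ∫ t in (0 : ℝ)..M.len e, (‖onEdge f e t‖ ^ 2 + ‖deriv (onEdge f e) t‖ ^ 2)

theorem edgeEnergy_nonneg (f : M.Point → ℂ) (e : M.graph.edgeSet) : 0 ≤ edgeEnergy f e :=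
  intervalIntegral.integral_nonneg (M.len_pos e).le fun t _ => by positivity

namespace MemH1

variable {f : M.Point → ℂ} (hf : MemH1 f)
include hf

theorem continuous_onEdge (e : M.graph.edgeSet) : Continuous (onEdge f e) :=
  hf.continuous.comp (continuous_edgePt e)

theorem intervalIntegrable_sq_deriv (e : M.graph.edgeSet) :
    IntervalIntegrable (fun t => ‖deriv (onEdge f e) t‖ ^ 2) volume 0 (M.len e) := by
  rw [intervalIntegrable_iff_integrableOn_Ioo_of_le (M.len_pos e).le]
  exact (memLp_two_iff_integrable_sq_norm (hf.memLp_deriv e).1).1 (hf.memLp_deriv e)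

theorem intervalIntegrable (e : M.graph.edgeSet) :
    IntervalIntegrable (fun t => ‖onEdge f e t‖ ^ 2 + ‖deriv (onEdge f e) t‖ ^ 2) volume 0
      (M.len e) :=
  (((hf.continuous_onEdge e).norm.pow 2).intervalIntegrable _ _).add
    (hf.intervalIntegrable_sq_deriv e)

theorem ofReal_edgeEnergy (e : M.graph.edgeSet) :
    ENNReal.ofReal (edgeEnergy f e) = (∫⁻ t in Ioo 0 (M.len e), ‖onEdge f e t‖ₑ ^ 2) +
      ∫⁻ t in Ioo 0 (M.len e), ‖deriv (onEdge f e) t‖ₑ ^ 2 := by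
  have hint := hf.intervalIntegrable e
  rw [intervalIntegrable_iff_integrableOn_Ioo_of_le (M.len_pos e).le] at hint
  rw [edgeEnergy, intervalIntegral.integral_of_le (M.len_pos e).le, integral_Ioc_eq_integral_Ioo,
    ofReal_integral_eq_lintegral_ofReal hint (ae_of_all _ fun t => by positivity),
    ← lintegral_add_left ((hf.continuous_onEdge e).enorm.measurable.pow_const 2)]
  refine lintegral_congr fun t => ?_
  rw [ENNReal.ofReal_add (by positivity) (by positivity), ENNReal.ofReal_pow (norm_nonneg _),
    ENNReal.ofReal_pow (norm_nonneg _), ofReal_norm, ofReal_norm]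

theorem tsum_ofReal_edgeEnergy :
    ∑' e, ENNReal.ofReal (edgeEnergy f e) = sqNormL2 f + energy f := by
  rw [sqNormL2, energy, ← ENNReal.tsum_add]
  exact tsum_congr hf.ofReal_edgeEnergy

theorem hasSum_edgeEnergy : HasSum (edgeEnergy f) (normH1 f ^ 2) := by
  have ne_top : ∑' e, ENNReal.ofReal (edgeEnergy f e) ≠ ∞ := by
    rw [hf.tsum_ofReal_edgeEnergy]
    exact ENNReal.add_ne_top.2 ⟨hf.sqNormL2_lt_top.ne, hf.energy_lt_top.ne⟩
  rw [normH1, Real.sq_sqrt ENNReal.toReal_nonneg, ← hf.tsum_ofReal_edgeEnergy,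
    ENNReal.tsum_toReal_eq fun _ => ENNReal.ofReal_ne_top]
  simpa only [ENNReal.toReal_ofReal (edgeEnergy_nonneg f _)] using ENNReal.hasSum_toReal ne_top

theorem hasSum_extendEdges : HasSum (M.extendEdges (edgeEnergy f)) (normH1 f ^ 2) :=
  (hasSum_extend_zero Subtype.val_injective).2 hf.hasSum_edgeEnergy

theorem sum_edges_le {l : List (Sym2 V)} (hl : l.Nodup) :
    (l.map (M.extendEdges (edgeEnergy f))).sum ≤ normH1 f ^ 2 := by
  classical
  rw [← List.sum_toFinset _ hl]
  exact sum_le_hasSum _ (fun e _ => extendEdges_nonneg (edgeEnergy_nonneg f) e)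
    hf.hasSum_extendEdges

theorem arcEnergyLE_edge (e : M.graph.edgeSet) {s t : ℝ} (hs : 0 ≤ s) (hst : s ≤ t)
    (ht : t ≤ M.len e) :
    ArcEnergyLE (f (M.edgePt e s)) (f (M.edgePt e t)) (t - s) (edgeEnergy f e) := by
  have sub : uIcc s t ⊆ uIcc 0 (M.len e) := by
    rw [uIcc_of_le hst, uIcc_of_le (M.len_pos e).le]
    exact Icc_subset_Icc hs ht
  refine (arcEnergyLE_of_absolutelyContinuousOnInterval hst ((hf.absolutelyContinuous e).mono sub)
    ((hf.intervalIntegrable_sq_deriv e).mono_set sub)).mono ?_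
  exact intervalIntegral.integral_mono_interval hs hst ht (ae_of_all _ fun t => by positivity)
    (hf.intervalIntegrable e)

theorem arcEnergyLE_adj {u v : V} (h : M.graph.Adj u v) :
    ArcEnergyLE (f (.vertex u)) (f (.vertex v)) (M.extendEdges M.len s(u, v))
      (M.extendEdges (edgeEnergy f) s(u, v)) := by
  let e : M.graph.edgeSet := ⟨s(u, v), h⟩
  have arc := hf.arcEnergyLE_edge e le_rfl (M.len_pos e).le le_rfl
  rw [edgePt_of_nonpos le_rfl, edgePt_of_len_le le_rfl, sub_zero, ← extendEdges_val M.len,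
    ← extendEdges_val (edgeEnergy f)] at arc
  rcases Sym2.eq_iff.1 (M.ends e) with ⟨hu, hv⟩ | ⟨hv, hu⟩ <;> rw [hu, hv] at arc
  exacts [arc, arc.symm]

theorem arcEnergyLE_walk {u v : V} (p : M.graph.Walk u v) :
    ArcEnergyLE (f (.vertex u)) (f (.vertex v)) (walkSum (M.extendEdges M.len) p)
      (walkSum (M.extendEdges (edgeEnergy f)) p) := by
  induction p with
  | nil => exact .refl _
  | cons h p ih =>
    rw [walkSum_cons, walkSum_cons]
    exact (hf.arcEnergyLE_adj h).trans ih

theorem arcEnergyLE_inner {a b : V} {e : M.graph.edgeSet} {x : ℂ} {l : ℝ}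
    (h : ArcEnergyLE x (f (.vertex a)) l (edgeEnergy f e)) {q : M.graph.Walk a b}
    (hq : q.IsTrail) (he : e.1 ∉ q.edges) :
    ArcEnergyLE x (f (.vertex b)) (l + walkSum (M.extendEdges M.len) q) (normH1 f ^ 2) := by
  refine (h.trans (hf.arcEnergyLE_walk q)).mono ?_
  have := hf.sum_edges_le (List.nodup_cons.2 ⟨he, hq.edges_nodup⟩)
  rwa [List.map_cons, List.sum_cons, extendEdges_val] at this

theorem exists_arcEnergyLE (hconn : M.graph.Connected) (x : M.Point) {u v : V}
    {p : M.graph.Walk u v} (hp : p.IsTrail) :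
    ∃ y l, M.walkLen p ≤ 2 * l ∧ ArcEnergyLE (f x) y l (normH1 f ^ 2) := by
  have len_nonneg : ∀ e, 0 ≤ M.extendEdges M.len e := extendEdges_nonneg fun e => (M.len_pos e).le
  rw [walkLen_eq]
  cases x with
  | vertex a =>
    obtain ⟨w, q, hq, hle⟩ := exists_isTrail_from hconn len_nonneg hp a
    exact ⟨_, _, hle, (hf.arcEnergyLE_walk q).mono (hf.sum_edges_le hq.edges_nodup)⟩
  | inner e t =>
    obtain ⟨ht, ht'⟩ := t.2
    have to_src := (hf.arcEnergyLE_edge e le_rfl ht.le ht'.le).symm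
    have to_tgt := hf.arcEnergyLE_edge e ht.le ht'.le le_rfl
    rw [edgePt_of_mem_Ioo t.2, edgePt_of_nonpos le_rfl, sub_zero] at to_src
    rw [edgePt_of_mem_Ioo t.2, edgePt_of_len_le le_rfl] at to_tgt
    have add_eq : (t : ℝ) + (M.len e - t) = M.extendEdges M.len s(M.src e, M.tgt e) := by
      rw [M.ends, extendEdges_val, add_sub_cancel]
    rcases exists_isTrail_from_edge hconn len_nonneg ht.le (sub_nonneg.2 ht'.le) add_eq hp with
      ⟨w, q, hq, he, hle⟩ | ⟨w, q, hq, he, hle⟩ <;> rw [M.ends] at he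
    · exact ⟨_, _, hle, hf.arcEnergyLE_inner to_src hq he⟩
    · exact ⟨_, _, hle, hf.arcEnergyLE_inner to_tgt hq he⟩

end MemH1

end MetricGraph

theorem tanh_monotone : Monotone Real.tanh := fun x y h => by
  rwa [← Real.artanh_le_artanh_iff ⟨Real.neg_one_lt_tanh x, Real.tanh_lt_one x⟩
    ⟨Real.neg_one_lt_tanh y, Real.tanh_lt_one y⟩, Real.artanh_tanh, Real.artanh_tanh]

theorem tendsto_tanh_atTop : Tendsto Real.tanh atTop (𝓝 1) := by
  refine tendsto_atTop_isLUB tanh_monotone ?_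
  rw [← Set.image_univ, Real.tanh_bijOn.image_eq]
  exact isLUB_Ioo (by norm_num)

theorem continuous_tanh : Continuous Real.tanh := by
  simp only [funext Real.tanh_eq_sinh_div_cosh]
  exact Real.continuous_sinh.div Real.continuous_cosh fun x => (Real.cosh_pos x).ne'

namespace MetricGraph

open SimpleGraph

variable {V : Type*} {M : MetricGraph V}

theorem diam_pos [Nontrivial V] (hconn : M.graph.Connected) : 0 < M.diam := by
  obtain ⟨v⟩ := hconn.nonempty
  obtain ⟨w, hw⟩ := hconn.preconnected.exists_adj_of_nontrivial v
  have len_pos : 0 < M.walkLen hw.toWalk := by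
    simpa [walkLen] using M.len_pos ⟨s(v, w), hw⟩
  refine (ENNReal.ofReal_pos.2 len_pos).trans_le ?_
  exact le_iSup_of_le v (le_iSup_of_le w (le_iSup
    (fun p : M.graph.Path v w => ENNReal.ofReal (M.walkLen p.1)) (Path.singleton hw)))

namespace MemH1

variable {f : M.Point → ℂ} (hf : MemH1 f) (hconn : M.graph.Connected) (x : M.Point)
include hf hconn

theorem tanh_mul_sq_norm_le {r : ℝ} (hr : ENNReal.ofReal r < M.diam) :
    Real.tanh (r / 2) * ‖f x‖ ^ 2 ≤ normH1 f ^ 2 := by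
  simp only [diam, lt_iSup_iff] at hr
  obtain ⟨u, v, p, hp⟩ := hr
  obtain ⟨y, l, hle, arc⟩ := hf.exists_arcEnergyLE hconn x p.2.isTrail
  have lt_len : r < M.walkLen p.1 := lt_of_not_ge fun h => hp.not_ge (ENNReal.ofReal_le_ofReal h)
  calc Real.tanh (r / 2) * ‖f x‖ ^ 2 ≤ Real.tanh l * ‖f x‖ ^ 2 := by
        gcongr
        exact tanh_monotone (by linarith)
    _ ≤ normH1 f ^ 2 := arc.tanh_mul_sq_norm_le

theorem norm_le_of_diam_eq_top (hd : M.diam = ∞) : ‖f x‖ ≤ normH1 f := by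
  have lim : Tendsto (fun r => Real.tanh (r / 2) * ‖f x‖ ^ 2) atTop (𝓝 (1 * ‖f x‖ ^ 2)) :=
    (tendsto_tanh_atTop.comp (tendsto_id.atTop_div_const two_pos)).mul_const _
  have sq_le := le_of_tendsto' lim fun r =>
    hf.tanh_mul_sq_norm_le hconn x (hd ▸ ENNReal.ofReal_lt_top)
  exact le_of_sq_le_sq (by rwa [one_mul] at sq_le) (Real.sqrt_nonneg _)

theorem norm_le_of_diam_ne_top [Nontrivial V] (hd : M.diam ≠ ∞) :
    ‖f x‖ ≤ √(Real.cosh (M.diam.toReal / 2) / Real.sinh (M.diam.toReal / 2)) * normH1 f := by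
  set D := M.diam.toReal
  have D_pos : 0 < D := ENNReal.toReal_pos (diam_pos hconn).ne' hd
  have tanh_le : Real.tanh (D / 2) * ‖f x‖ ^ 2 ≤ normH1 f ^ 2 := by
    have lim : Tendsto (fun r => Real.tanh (r / 2) * ‖f x‖ ^ 2) (𝓝[<] D)
        (𝓝 (Real.tanh (D / 2) * ‖f x‖ ^ 2)) :=
      ((continuous_tanh.comp (continuous_id.div_const 2)).mul
        continuous_const).continuousAt.mono_left nhdsWithin_le_nhds
    refine le_of_tendsto lim (eventually_nhdsWithin_of_forall fun r hr => ?_)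
    refine hf.tanh_mul_sq_norm_le hconn x ?_
    rw [← ENNReal.ofReal_toReal hd]
    exact (ENNReal.ofReal_lt_ofReal_iff D_pos).2 hr
  have cosh_pos := Real.cosh_pos (D / 2)
  have sinh_pos : 0 < Real.sinh (D / 2) := Real.sinh_pos_iff.2 (half_pos D_pos)
  rw [Real.tanh_eq_sinh_div_cosh, div_mul_eq_mul_div, div_le_iff₀ cosh_pos] at tanh_le
  refine le_of_sq_le_sq ?_ (mul_nonneg (Real.sqrt_nonneg _) (Real.sqrt_nonneg _))
  rw [mul_pow, Real.sq_sqrt (by positivity), div_mul_eq_mul_div, le_div_iff₀ sinh_pos]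
  linarith

theorem norm_le [Nontrivial V] : ‖f x‖ ≤ M.sobolevConst * normH1 f := by
  rw [sobolevConst]
  split_ifs with hd
  · rw [one_mul]
    exact hf.norm_le_of_diam_eq_top hconn x hd
  · exact hf.norm_le_of_diam_ne_top hconn x hd

end MemH1

end MetricGraph

/-! ### Oscillation outside a finite set of edges -/

namespace MetricGraph

open SimpleGraph Set

variable {V : Type*} {M : MetricGraph V}

namespace MemH1

variable {f : M.Point → ℂ} (hf : MemH1 f)
include hf

theorem exists_finset_sum_edges_lt {ε : ℝ} (hε : 0 < ε) :
    ∃ K : Finset (Sym2 V), ∀ l : List (Sym2 V), l.Nodup → (∀ e ∈ l, e ∉ K) →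
      (l.map (M.extendEdges (edgeEnergy f))).sum < ε := by
  classical
  obtain ⟨K, hK⟩ := summable_iff_vanishing_norm.1 hf.hasSum_extendEdges.summable ε hε
  refine ⟨K, fun l hl hlK => ?_⟩
  rw [← List.sum_toFinset _ hl]
  exact (le_abs_self _).trans_lt (hK _ (Finset.disjoint_left.2 fun e he =>
    hlK e (List.mem_toFinset.1 he)))

theorem exists_finset_norm_sub_le {ε : ℝ} (hε : 0 < ε) :
    ∃ K : Finset (Sym2 V),
      (∀ ⦃u v⦄ (p : M.graph.Walk u v), (∀ e ∈ p.edges, e ∉ K) →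
        ‖f (.vertex v) - f (.vertex u)‖ ≤ ε) ∧
      ∀ ⦃e : M.graph.edgeSet⦄, e.1 ∉ K → ∀ ⦃x⦄, x ∈ M.closedEdge e → ∀ ⦃y⦄, y ∈ M.closedEdge e →
        ‖f y - f x‖ ≤ ε := by
  classical
  obtain ⟨K, hK⟩ := hf.exists_finset_sum_edges_lt (show 0 < ε ^ 2 / 2 by positivity)
  have norm_sub_le {x y : ℂ} {l η : ℝ} (arc : ArcEnergyLE x y l η) (hη : η < ε ^ 2 / 2) :
      ‖y - x‖ ≤ ε := le_of_sq_le_sq (by linarith [arc.sq_norm_sub_le]) hε.le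
  refine ⟨K, fun u v p hp => ?_, fun e he => ?_⟩
  · exact norm_sub_le (hf.arcEnergyLE_walk p.bypass) (hK _ p.bypass_isPath.isTrail.edges_nodup
      fun e he => hp e (p.edges_bypass_subset_edges he))
  · have energy_lt : edgeEnergy f e < ε ^ 2 / 2 := by
      simpa [extendEdges_val] using hK [e.1] (List.nodup_singleton _) (by simpa using he)
    rintro _ ⟨s, hs, rfl⟩ _ ⟨t, ht, rfl⟩
    rcases le_total s t with hst | hst
    · exact norm_sub_le (hf.arcEnergyLE_edge e hs.1 hst ht.2) energy_lt
    · exact norm_sub_le (hf.arcEnergyLE_edge e ht.1 hst hs.2).symm energy_lt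

theorem exists_finset_norm_sub_le_of_isPreconnected {ε : ℝ} (hε : 0 < ε) :
    ∃ K : Finset (Sym2 V), ∀ ⦃U : Set M.Point⦄, IsOpen U → IsPreconnected U →
      (∀ e : M.graph.edgeSet, e.1 ∈ K → Disjoint U (M.closedEdge e)) →
        ∀ ⦃v⦄, .vertex v ∈ U → ∀ ⦃x⦄, x ∈ U → ‖f x - f (.vertex v)‖ ≤ ε := by
  obtain ⟨K, walk_le, edge_le⟩ := hf.exists_finset_norm_sub_le (half_pos hε)
  refine ⟨K, fun U hU hU' hUK v hv x hx => ?_⟩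
  have notMem {e : M.graph.edgeSet} {y : M.Point} (hy : y ∈ U) (hye : y ∈ M.closedEdge e) :
      e.1 ∉ K := fun he => Set.disjoint_left.1 (hUK e he) hy hye
  obtain ⟨w, hxw, p, hp⟩ := exists_walk_mem_openStar hU hU' hv hx
  have le_walk : ‖f (.vertex w) - f (.vertex v)‖ ≤ ε / 2 := walk_le p fun e he => by
    induction e with
    | h a b =>
      exact notMem (e := ⟨_, p.edges_subset_edgeSet he⟩)
        (hp a (p.fst_mem_support_of_mem_edges he))
        (vertex_mem_closedEdge_iff.2 (Sym2.mem_mk_left a b))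
  have le_edge : ‖f x - f (.vertex w)‖ ≤ ε / 2 := by
    rcases hxw with rfl | ⟨e, t, rfl, hwe⟩
    · simpa using (half_pos hε).le
    · have mem := inner_mem_closedEdge_iff (t := t).2 rfl
      exact edge_le (notMem hx mem) (vertex_mem_closedEdge_iff.2 hwe) mem
  calc ‖f x - f (.vertex v)‖ ≤ _ := norm_sub_le_norm_sub_add_norm_sub _ (f (.vertex w)) _
    _ ≤ ε := by linarith

end MemH1

end MetricGraph

/-! ### Rays and ends -/

namespace GraphRay

open SimpleGraph

variable {V : Type*} {G : SimpleGraph V}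

/-- With `d v` the least length of a climbing walk from `v`, the first step of a shortest such walk
climbs or decreases `d`. -/
theorem exists_adj_toLex_lt {D : V → ℕ}
    (climb : ∀ v, ∃ w, D v < D w ∧ ∃ p : G.Walk v w, ∀ x ∈ p.support, D v ≤ D x) :
    ∃ d : V → ℕᵒᵈ, ∀ v, ∃ w, G.Adj v w ∧ toLex (D v, d v) < toLex (D w, d w) := by
  let lengths (v : V) : Set ℕ :=
    {k | ∃ w, D v < D w ∧ ∃ p : G.Walk v w, p.length = k ∧ ∀ x ∈ p.support, D v ≤ D x}
  have lengths_nonempty (v : V) : (lengths v).Nonempty :=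
    let ⟨w, hw, p, hp⟩ := climb v
    ⟨_, w, hw, p, rfl, hp⟩
  refine ⟨fun v => .toDual (sInf (lengths v)), fun v => ?_⟩
  obtain ⟨w, hw, p, hlen, hp⟩ := Nat.sInf_mem (lengths_nonempty v)
  cases p with
  | nil => exact absurd hw (lt_irrefl _)
  | @cons _ v' _ h p =>
    refine ⟨v', h, Prod.Lex.toLex_lt_toLex.2 ?_⟩
    rcases (hp v' (by simp)).lt_or_eq with hlt | heq
    · exact .inl hlt
    · refine .inr ⟨heq, OrderDual.toDual_lt_toDual.2 ?_⟩
      have mem : p.length ∈ lengths v' :=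
        ⟨w, heq ▸ hw, p, rfl, fun x hx => heq ▸ hp x (by simp [hx])⟩
      rw [Walk.length_cons] at hlen
      exact (Nat.sInf_le mem).trans_lt (by omega)

theorem exists_tendsto_atTop [Nonempty V] {D : V → ℕ}
    (climb : ∀ v, ∃ w, D v < D w ∧ ∃ p : G.Walk v w, ∀ x ∈ p.support, D v ≤ D x) :
    ∃ R : GraphRay G, Tendsto (fun n => D (R.vert n)) atTop atTop := by
  obtain ⟨d, hd⟩ := exists_adj_toLex_lt climb
  choose next adj_next lt_next using hd
  let r (n : ℕ) : V := next^[n] (Classical.arbitrary V)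
  have r_succ (n : ℕ) : r (n + 1) = next (r n) := Function.iterate_succ_apply' ..
  have lex_strictMono : StrictMono fun n => toLex (D (r n), d (r n)) :=
    strictMono_nat_of_lt_succ fun n => r_succ n ▸ lt_next (r n)
  refine ⟨⟨r, .of_comp (f := fun v => toLex (D v, d v)) lex_strictMono.injective,
    fun n => r_succ n ▸ adj_next (r n)⟩, ?_⟩
  have D_monotone : Monotone fun n => D (r n) := fun m n h =>
    Prod.Lex.monotone_fst _ _ (lex_strictMono.monotone h)
  refine (tendsto_atTop_of_monotone D_monotone).resolve_right fun ⟨l, hl⟩ => ?_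
  rw [nhds_discrete, tendsto_pure, eventually_atTop] at hl
  obtain ⟨N, hN⟩ := hl
  have d_strictMono : StrictMono fun n => d (r (N + n)) := strictMono_nat_of_lt_succ fun n =>
    ((Prod.Lex.toLex_lt_toLex.1 (lex_strictMono (N + n).lt_succ_self)).resolve_left fun h =>
      h.ne ((hN _ (by omega)).trans (hN _ (by omega)).symm)).2
  exact not_strictMono_of_wellFoundedGT _ d_strictMono

/-- The ray without its first `N` vertices. -/
def tail (R : GraphRay G) (N : ℕ) : GraphRay G where
  vert n := R.vert (N + n)
  injective := R.injective.comp (add_right_injective N)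
  adj n := R.adj (N + n)

theorem equivalent_tail (R : GraphRay G) (N : ℕ) : (R.tail N).Equivalent R := by
  have sub : Set.range (R.tail N).vert ⊆ Set.range R.vert :=
    Set.range_subset_iff.2 fun n => ⟨N + n, rfl⟩
  have infinite := Set.infinite_range_of_injective (R.tail N).injective
  exact ⟨R.tail N, by rwa [Set.inter_self], by rwa [Set.inter_eq_left.2 sub]⟩

theorem Equivalent.symm {R R' : GraphRay G} (h : R.Equivalent R') : R'.Equivalent R :=
  let ⟨R₃, h₁, h₂⟩ := h
  ⟨R₃, h₂, h₁⟩

theorem edge_injective (R : GraphRay G) : Function.Injective R.edge := by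
  intro m n h
  rcases Sym2.eq_iff.1 (congrArg Subtype.val h) with ⟨h₁, -⟩ | ⟨h₁, h₂⟩
  · exact R.injective h₁
  · have := R.injective h₁
    have := R.injective h₂
    omega

theorem eventually_edge_notMem (R : GraphRay G) {K : Set G.edgeSet} (hK : K.Finite) :
    ∀ᶠ n in atTop, R.edge n ∉ K :=
  Nat.cofinite_eq_atTop ▸ R.edge_injective.tendsto_cofinite hK.compl_mem_cofinite

theorem exists_walk (R : GraphRay G) {m n : ℕ} (hmn : m ≤ n) :
    ∃ p : G.Walk (R.vert m) (R.vert n), ∀ e ∈ p.edges, ∃ k ≥ m, (R.edge k).1 = e := by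
  induction n, hmn using Nat.le_induction with
  | base => exact ⟨.nil, by simp⟩
  | succ n hmn ih =>
    obtain ⟨p, hp⟩ := ih
    refine ⟨p.concat (R.adj n), fun e he => ?_⟩
    rw [Walk.edges_concat, List.concat_eq_append, List.mem_append, List.mem_singleton] at he
    rcases he with he | rfl
    exacts [hp e he, ⟨n, hmn, rfl⟩]

theorem map_vert_atTop (R : GraphRay G) :
    map R.vert atTop = cofinite ⊓ 𝓟 (Set.range R.vert) := by
  rw [← Nat.cofinite_eq_atTop, ← R.injective.comap_cofinite_eq, map_comap]

theorem tendsto_unique_of_infinite {X : Type*} [TopologicalSpace X] [T2Space X] {g : V → X}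
    {R R' : GraphRay G} (hinf : (Set.range R.vert ∩ Set.range R'.vert).Infinite) {L L' : X}
    (h : Tendsto (fun n => g (R.vert n)) atTop (𝓝 L))
    (h' : Tendsto (fun n => g (R'.vert n)) atTop (𝓝 L')) : L = L' := by
  rw [← Function.comp_def, ← tendsto_map'_iff, map_vert_atTop] at h h'
  have := cofinite_inf_principal_neBot_iff.2 hinf
  exact tendsto_nhds_unique
    (h.mono_left (inf_le_inf_left _ (principal_mono.2 Set.inter_subset_left)))
    (h'.mono_left (inf_le_inf_left _ (principal_mono.2 Set.inter_subset_right)))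

end GraphRay

namespace MetricGraph.MemH1

variable {V : Type*} {M : MetricGraph V} {f : M.Point → ℂ} (hf : MemH1 f)
include hf

theorem exists_tendsto_ray (R : GraphRay M.graph) :
    ∃ L, Tendsto (fun n => f (.vertex (R.vert n))) atTop (𝓝 L) := by
  refine cauchySeq_tendsto_of_complete (Metric.cauchySeq_iff'.2 fun ε hε => ?_)
  obtain ⟨K, hK, -⟩ := hf.exists_finset_norm_sub_le (half_pos hε)
  obtain ⟨N, hN⟩ := eventually_atTop.1
    (R.eventually_edge_notMem (K.finite_toSet.preimage Subtype.val_injective.injOn))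
  refine ⟨N, fun n hn => ?_⟩
  obtain ⟨p, hp⟩ := R.exists_walk hn
  rw [dist_eq_norm]
  refine (hK p fun e he => ?_).trans_lt (half_lt_self hε)
  obtain ⟨k, hk, rfl⟩ := hp e he
  exact hN k hk

theorem tendsto_of_equivalent {R R' : GraphRay M.graph} (h : R.Equivalent R') {L : ℂ}
    (hL : Tendsto (fun n => f (.vertex (R.vert n))) atTop (𝓝 L)) :
    Tendsto (fun n => f (.vertex (R'.vert n))) atTop (𝓝 L) := by
  obtain ⟨R₃, h₁, h₂⟩ := h
  obtain ⟨L₃, h₃⟩ := hf.exists_tendsto_ray R₃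
  obtain ⟨L', hL'⟩ := hf.exists_tendsto_ray R'
  have eq₁ : L₃ = L := GraphRay.tendsto_unique_of_infinite (g := fun v => f (.vertex v)) h₁ h₃ hL
  have eq₂ : L₃ = L' := GraphRay.tendsto_unique_of_infinite (g := fun v => f (.vertex v)) h₂ h₃ hL'
  rwa [← eq₁, eq₂]

theorem tendsto_iff_of_belongsTo {R R' : GraphRay M.graph} {ω : GraphEnd M.graph}
    (h : R.BelongsTo ω) (h' : R'.BelongsTo ω) (L : ℂ) :
    Tendsto (fun n => f (.vertex (R.vert n))) atTop (𝓝 L) ↔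
      Tendsto (fun n => f (.vertex (R'.vert n))) atTop (𝓝 L) := by
  have lift_eq := congrArg (Quot.lift
    (fun (R : GraphRay M.graph) (L : ℂ) => Tendsto (fun n => f (.vertex (R.vert n))) atTop (𝓝 L))
    fun R R' h => funext fun L =>
      propext ⟨hf.tendsto_of_equivalent h, hf.tendsto_of_equivalent h.symm⟩) (Eq.trans h h'.symm)
  exact (congrFun lift_eq L).to_iff

end MetricGraph.MemH1

theorem subset_of_isPreconnected_of_disjoint_frontier {X : Type*} [TopologicalSpace X] {S U : Set X}
    (hS : IsPreconnected S) (hU : IsOpen U) (hSU : Disjoint S (frontier U))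
    (hne : (S ∩ U).Nonempty) : S ⊆ U := by
  refine hS.subset_left_of_subset_union hU isClosed_closure.isOpen_compl
    (disjoint_compl_right.mono_left subset_closure) (fun x hx => ?_) hne
  refine or_iff_not_imp_left.2 fun hxU hxc => Set.disjoint_left.1 hSU hx ?_
  rw [hU.frontier_eq]
  exact ⟨hxc, hxU⟩

namespace MetricGraph

open SimpleGraph Set

variable {V : Type*} {M : MetricGraph V}

theorem closedEdge_subset_of_inner_notMem_frontier {U : Set M.Point} (hU : IsOpen U)
    {e : M.graph.edgeSet} (hV : ∀ v ∈ e.1, .vertex v ∈ U)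
    (he : ∀ t, .inner e t ∉ frontier U) : M.closedEdge e ⊆ U := by
  refine subset_of_isPreconnected_of_disjoint_frontier (isPreconnected_closedEdge e) hU ?_ ?_
  · refine Set.disjoint_left.2 fun x hx hxU => ?_
    cases x with
    | vertex v =>
      rw [hU.frontier_eq] at hxU
      exact hxU.2 (hV v (vertex_mem_closedEdge_iff.1 hx))
    | inner e' t =>
      obtain rfl := inner_mem_closedEdge_iff.1 hx
      exact he t hxU
  · have mem := mem_edge_iff.2 (.inl (Eq.refl (M.src e)))
    exact ⟨_, vertex_mem_closedEdge_iff.2 mem, hV _ mem⟩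

theorem vertex_mem_rayCarrier (R : GraphRay M.graph) (n : ℕ) :
    .vertex (R.vert n) ∈ M.rayCarrier R :=
  mem_iUnion.2 ⟨n, vertex_mem_closedEdge_iff.2 (Sym2.mem_mk_left _ _)⟩

namespace EndSeq

variable (s : M.EndSeq)

theorem antitone : Antitone s.U := antitone_nat_of_succ_le s.decreasing

theorem eventually_disjoint {Q : Set M.Point} (hQ : IsCompact Q) :
    ∀ᶠ n in atTop, Disjoint (s.U n) Q := by
  obtain ⟨N, hN⟩ := hQ.elim_directed_family_closed (fun n => closure (s.U n))
    (fun n => isClosed_closure) (by rw [s.iInter_closure, inter_empty])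
    (antitone_nat_of_succ_le fun n => closure_mono (s.decreasing n)).directed_ge
  filter_upwards [eventually_ge_atTop N] with n hn
  exact (disjoint_iff_inter_eq_empty.2 hN).symm.mono_left ((s.antitone hn).trans subset_closure)

theorem exists_vertex_mem (n : ℕ) : ∃ v, .vertex v ∈ s.U n := by
  by_contra! h
  obtain ⟨e, he⟩ := exists_subset_closedEdge (s.isOpen n) (s.isConnected n) h
  obtain ⟨m, disj, hnm⟩ := ((s.eventually_disjoint (isCompact_closedEdge e)).and
    (eventually_ge_atTop n)).exists
  exact (s.isConnected m).nonempty.ne_empty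
    (disjoint_self.1 (disj.mono_right ((s.antitone hnm).trans he)))

theorem exists_walk_forall_mem {n : ℕ} {v w : V} (hv : .vertex v ∈ s.U n)
    (hw : .vertex w ∈ s.U n) : ∃ p : M.graph.Walk v w, ∀ x ∈ p.support, .vertex x ∈ s.U n := by
  obtain ⟨w', h | ⟨e, t, h, -⟩, hp⟩ :=
    exists_walk_mem_openStar (s.isOpen n) (s.isConnected n).isPreconnected hv hw
  · cases h
    exact hp
  · cases h

theorem exists_ray_eventually_mem (hconn : M.graph.Connected) :
    ∃ R : GraphRay M.graph, ∀ n, ∀ᶠ i in atTop, .vertex (R.vert i) ∈ s.U n := by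
  classical
  have exists_notMem (v : V) : ∃ n, .vertex v ∉ s.U n := by
    by_contra! h
    exact (s.iInter_closure ▸ mem_iInter.2 fun n => subset_closure (h n) :
      Point.vertex v ∈ (∅ : Set M.Point))
  let depth (v : V) : ℕ := Nat.find (exists_notMem v)
  have lt_depth_iff {n : ℕ} {v : V} : n < depth v ↔ .vertex v ∈ s.U n := by
    rw [Nat.lt_find_iff]
    exact ⟨fun h => not_not.1 (h n le_rfl), fun h m hm => not_not.2 (s.antitone hm h)⟩
  have climb (v : V) :
      ∃ w, depth v < depth w ∧ ∃ p : M.graph.Walk v w, ∀ x ∈ p.support, depth v ≤ depth x := by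
    obtain ⟨w, hw⟩ := s.exists_vertex_mem (depth v)
    refine ⟨w, lt_depth_iff.2 hw, ?_⟩
    rcases hd : depth v with - | n
    · exact (hconn.preconnected v w).elim fun p => ⟨p, fun _ _ => Nat.zero_le _⟩
    · have hv : .vertex v ∈ s.U n := lt_depth_iff.1 (hd ▸ n.lt_succ_self)
      obtain ⟨p, hp⟩ := s.exists_walk_forall_mem hv (s.antitone (hd ▸ n.le_succ) hw)
      exact ⟨p, fun x hx => lt_depth_iff.2 (hp x hx)⟩
  have := hconn.nonempty
  obtain ⟨R, hR⟩ := GraphRay.exists_tendsto_atTop climb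
  exact ⟨R, fun n => (hR.eventually_gt_atTop n).mono fun i hi => lt_depth_iff.1 hi⟩

theorem exists_rayCarrier_tail_subset {R : GraphRay M.graph} {n : ℕ}
    (hR : ∀ᶠ i in atTop, .vertex (R.vert i) ∈ s.U n) :
    ∃ N, M.rayCarrier (R.tail N) ⊆ s.U n := by
  obtain ⟨N, hN⟩ := eventually_atTop.1
    (hR.and (R.eventually_edge_notMem (finite_setOf_inner_mem (s.isCompact_frontier n))))
  refine ⟨N, iUnion_subset fun k => closedEdge_subset_of_inner_notMem_frontier (s.isOpen n)
    (fun v hv => ?_) fun t ht => (hN (N + k) (by omega)).2 ⟨t, ht⟩⟩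
  rcases Sym2.mem_iff.1 hv with rfl | rfl
  exacts [(hN _ (by omega)).1, (hN (N + (k + 1)) (by omega)).1]

/-- The sequence without its first `n` members. -/
def shift (n : ℕ) : M.EndSeq where
  U k := s.U (n + k)
  isOpen _ := s.isOpen _
  isConnected _ := s.isConnected _
  isCompact_frontier _ := s.isCompact_frontier _
  decreasing _ := s.decreasing _
  iInter_closure := subset_eq_empty
    (subset_iInter fun k => (iInter_subset _ k).trans (closure_mono (s.antitone (k.le_add_left n))))
    s.iInter_closure

variable {s} {s' : M.EndSeq} {γ : M.TopEnd}

theorem Represents.shift (h : s.Represents γ) (n : ℕ) : (s.shift n).Represents γ :=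
  (Quotient.sound fun k => ⟨⟨n + k, subset_rfl⟩, ⟨k, s.antitone (k.le_add_left n)⟩⟩ :
    (⟦s.shift n⟧ : M.TopEnd) = ⟦s⟧).trans h

theorem Represents.exists_subset (h : s.Represents γ) (h' : s'.Represents γ) (n : ℕ) :
    ∃ j, s.U j ⊆ s'.U n :=
  ((Quotient.exact (Eq.trans h h'.symm) : s ≈ s') n).2

end EndSeq

theorem exists_represents (γ : M.TopEnd) : ∃ s : M.EndSeq, s.Represents γ := Quotient.exists_rep γ

theorem exists_corresponds (hconn : M.graph.Connected) (γ : M.TopEnd) :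
    ∃ ω : GraphEnd M.graph, M.Corresponds γ ω := by
  obtain ⟨s, hs⟩ := exists_represents γ
  obtain ⟨R, hR⟩ := s.exists_ray_eventually_mem hconn
  refine ⟨Quot.mk _ R, fun s' hs' n => ?_⟩
  obtain ⟨j, hj⟩ := hs.exists_subset hs' n
  obtain ⟨N, hN⟩ := s.exists_rayCarrier_tail_subset (hR j)
  exact ⟨R.tail N, Quot.sound (R.equivalent_tail N), hN.trans hj⟩

end MetricGraph

/-! ### The end compactification -/

namespace MetricGraph

open Set

variable {V : Type*} {M : MetricGraph V}

theorem point_mem_hat_iff {U : Set M.Point} {x : M.Point} : .point x ∈ M.hat U ↔ x ∈ U := by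
  simp [hat]

theorem topEnd_mem_hat_iff {U : Set M.Point} {γ : M.TopEnd} :
    .topEnd γ ∈ M.hat U ↔ ∃ s : M.EndSeq, s.Represents γ ∧ s.U 0 ⊆ U := by
  simp [hat]

theorem EndSeq.Represents.topEnd_mem_hat {s : M.EndSeq} {γ : M.TopEnd} (h : s.Represents γ)
    (n : ℕ) : .topEnd γ ∈ M.hat (s.U n) :=
  topEnd_mem_hat_iff.2 ⟨s.shift n, h.shift n, subset_rfl⟩

theorem EndSeq.Represents.exists_subset_of_mem_hat {s : M.EndSeq} {γ : M.TopEnd}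
    (h : s.Represents γ) {U : Set M.Point} (hU : .topEnd γ ∈ M.hat U) : ∃ n, s.U n ⊆ U := by
  obtain ⟨s', hs', hsub⟩ := topEnd_mem_hat_iff.1 hU
  exact (h.exists_subset hs' 0).imp fun _ hj => hj.trans hsub

theorem hat_mono {U W : Set M.Point} (h : U ⊆ W) : M.hat U ⊆ M.hat W :=
  union_subset_union (image_mono h) (image_mono fun _ ⟨s, hs, hsU⟩ => ⟨s, hs, hsU.trans h⟩)

theorem hat_univ : M.hat univ = univ := by
  refine eq_univ_of_forall fun z => ?_
  cases z with
  | point x => exact point_mem_hat_iff.2 (mem_univ x)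
  | topEnd γ =>
    obtain ⟨s, hs⟩ := exists_represents γ
    exact topEnd_mem_hat_iff.2 ⟨s, hs, subset_univ _⟩

theorem hat_inter (U W : Set M.Point) : M.hat (U ∩ W) = M.hat U ∩ M.hat W := by
  refine (subset_inter (hat_mono inter_subset_left) (hat_mono inter_subset_right)).antisymm ?_
  rintro (x | γ) ⟨hU, hW⟩
  · exact point_mem_hat_iff.2 ⟨point_mem_hat_iff.1 hU, point_mem_hat_iff.1 hW⟩
  · obtain ⟨s, hs⟩ := exists_represents γ
    obtain ⟨m, hm⟩ := hs.exists_subset_of_mem_hat hU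
    obtain ⟨n, hn⟩ := hs.exists_subset_of_mem_hat hW
    refine hat_mono (subset_inter ?_ ?_) (hs.topEnd_mem_hat (max m n))
    exacts [(s.antitone (le_max_left m n)).trans hm, (s.antitone (le_max_right m n)).trans hn]

theorem isTopologicalBasis_hat :
    TopologicalSpace.IsTopologicalBasis {W | ∃ U : Set M.Point, IsOpen U ∧ W = M.hat U} :=
  TopologicalSpace.isTopologicalBasis_of_subbasis_of_finiteInter rfl
    { univ_mem := ⟨univ, isOpen_univ, hat_univ.symm⟩
      inter_mem := by
        rintro _ ⟨U, hU, rfl⟩ _ ⟨W, hW, rfl⟩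
        exact ⟨U ∩ W, hU.inter hW, (hat_inter U W).symm⟩ }

theorem isInducing_point : IsInducing (EndCompactification.point : M.Point → _) := by
  have preimage_hat (U : Set M.Point) : EndCompactification.point ⁻¹' M.hat U = U :=
    ext fun _ => point_mem_hat_iff
  refine ⟨Eq.trans ?_ induced_generateFrom_eq.symm⟩
  convert (TopologicalSpace.generateFrom_setOfPred_isOpen
    (inferInstance : TopologicalSpace M.Point)).symm
  ext U
  constructor
  · rintro ⟨_, ⟨W, hW, rfl⟩, rfl⟩
    exact (preimage_hat W).symm ▸ hW
  · exact fun hU => ⟨_, ⟨U, hU, rfl⟩, preimage_hat U⟩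

theorem denseRange_point : DenseRange (EndCompactification.point : M.Point → _) := by
  refine isTopologicalBasis_hat.dense_iff.2 ?_
  rintro _ ⟨U, -, rfl⟩ ⟨x | γ, hz⟩
  · exact ⟨.point x, hz, mem_range_self x⟩
  · obtain ⟨s, -, hsU⟩ := topEnd_mem_hat_iff.1 hz
    obtain ⟨x, hx⟩ := (s.isConnected 0).nonempty
    exact ⟨.point x, point_mem_hat_iff.2 (hsU hx), mem_range_self x⟩

theorem isDenseInducing_point : IsDenseInducing (EndCompactification.point : M.Point → _) :=
  ⟨isInducing_point, denseRange_point⟩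

theorem EndSeq.Represents.hasBasis_comap_nhds {s : M.EndSeq} {γ : M.TopEnd}
    (h : s.Represents γ) : (comap EndCompactification.point (𝓝 (.topEnd γ))).HasBasis
      (fun _ : ℕ => True) s.U := by
  refine ⟨fun S => ⟨?_, ?_⟩⟩
  · rintro ⟨T, hT, hTS⟩
    obtain ⟨_, ⟨U, -, rfl⟩, hU, hUT⟩ := isTopologicalBasis_hat.mem_nhds_iff.1 hT
    obtain ⟨n, hn⟩ := h.exists_subset_of_mem_hat hU
    exact ⟨n, trivial, fun x hx => hTS (hUT (point_mem_hat_iff.2 (hn hx)))⟩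
  · rintro ⟨n, -, hn⟩
    refine ⟨M.hat (s.U n), isTopologicalBasis_hat.mem_nhds ⟨_, s.isOpen n, rfl⟩
      (h.topEnd_mem_hat n), fun x hx => hn (point_mem_hat_iff.1 hx)⟩

namespace MemH1

variable {f : M.Point → ℂ} (hf : MemH1 f)
include hf

theorem exists_tendsto_comap_nhds (z : M.EndCompactification) :
    ∃ L, Tendsto f (comap EndCompactification.point (𝓝 z)) (𝓝 L) := by
  cases z with
  | point x => exact ⟨f x, isInducing_point.nhds_eq_comap x ▸ hf.continuous.tendsto x⟩
  | topEnd γ =>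
    have := isDenseInducing_point.comap_nhds_neBot (.topEnd γ)
    refine CompleteSpace.complete (Metric.cauchy_iff.2 ⟨inferInstance, fun ε hε => ?_⟩)
    obtain ⟨s, hs⟩ := exists_represents γ
    obtain ⟨K, hK⟩ := hf.exists_finset_norm_sub_le_of_isPreconnected (show 0 < ε / 3 by positivity)
    obtain ⟨n, hn⟩ := ((eventually_all_finite (K.finite_toSet.preimage
      Subtype.val_injective.injOn)).2 fun e _ =>
        s.eventually_disjoint (M.isCompact_closedEdge e)).exists
    obtain ⟨v, hv⟩ := s.exists_vertex_mem n
    have osc : ∀ x ∈ s.U n, dist (f x) (f (.vertex v)) ≤ ε / 3 := fun x hx =>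
      dist_eq_norm (f x) _ ▸ hK (s.isOpen n) (s.isConnected n).isPreconnected hn hv hx
    refine ⟨f '' s.U n, image_mem_map (hs.hasBasis_comap_nhds.mem_of_mem trivial), ?_⟩
    rintro _ ⟨x, hx, rfl⟩ _ ⟨y, hy, rfl⟩
    linarith [dist_triangle_right (f x) (f y) (f (.vertex v)), osc x hx, osc y hy]

theorem tendsto_of_corresponds {F : M.EndCompactification → ℂ} (hF : Continuous F)
    (hFf : ∀ x, F (.point x) = f x) {γ : M.TopEnd} {ω : GraphEnd M.graph}
    (hω : M.Corresponds γ ω) {R : GraphRay M.graph} (hR : R.BelongsTo ω) :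
    Tendsto (fun n => f (.vertex (R.vert n))) atTop (𝓝 (F (.topEnd γ))) := by
  obtain ⟨L, hL⟩ := hf.exists_tendsto_ray R
  suffices h : L = F (.topEnd γ) by rwa [← h]
  by_contra hne
  obtain ⟨O, O', hO, hO', hLO, hFO', disj⟩ := t2_separation hne
  obtain ⟨s, hs⟩ := exists_represents γ
  obtain ⟨n, -, hn⟩ := hs.hasBasis_comap_nhds.mem_iff.1
    (preimage_mem_comap (hF.continuousAt (hO'.mem_nhds hFO')))
  obtain ⟨R', hR', hsub⟩ := hω s hs n
  obtain ⟨k, hk⟩ := (((hf.tendsto_iff_of_belongsTo hR hR' L).1 hL).eventually_mem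
    (hO.mem_nhds hLO)).exists
  have mem_O' : F (.point (.vertex (R'.vert k))) ∈ O' := hn (hsub (vertex_mem_rayCarrier R' k))
  exact Set.disjoint_left.1 disj hk (hFf _ ▸ mem_O')

end MemH1

end MetricGraph

theorem proposition3p4_general {V : Type*} [Nontrivial V] (M : MetricGraph V)
    (hconn : M.graph.Connected) (f : M.Point → ℂ) (hf : MetricGraph.MemH1 f) :
    ∃ F : M.EndCompactification → ℂ,
      (Continuous F ∧ ∀ x, F (.point x) = f x) ∧
      (∀ F' : M.EndCompactification → ℂ,
        (Continuous F' ∧ ∀ x, F' (.point x) = f x) → F' = F) ∧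
      (∀ γ : M.TopEnd,
        (∃ ω : GraphEnd M.graph, M.Corresponds γ ω) ∧
        ∀ ω : GraphEnd M.graph, M.Corresponds γ ω →
          ∀ R : GraphRay M.graph, R.BelongsTo ω →
            Tendsto (fun n => f (.vertex (R.vert n))) atTop (𝓝 (F (.topEnd γ)))) ∧
      BddAbove (Set.range fun z => ‖F z‖) ∧
      (⨆ x : M.Point, ‖f x‖) = (⨆ z : M.EndCompactification, ‖F z‖) ∧
      (⨆ z : M.EndCompactification, ‖F z‖) ≤ M.sobolevConst * MetricGraph.normH1 f := by
  have di := MetricGraph.isDenseInducing_point (M := M)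
  set F := di.extend f
  have continuous_F : Continuous F := di.continuous_extend hf.exists_tendsto_comap_nhds
  have F_point : ∀ x, F (.point x) = f x := di.extend_eq hf.continuous
  have norm_F_le (z) : ‖F z‖ ≤ M.sobolevConst * MetricGraph.normH1 f :=
    di.dense.induction_on z (isClosed_le continuous_F.norm continuous_const) fun x =>
      F_point x ▸ hf.norm_le hconn x
  obtain ⟨v⟩ := hconn.nonempty
  have : Nonempty M.EndCompactification := ⟨.point (.vertex v)⟩
  refine ⟨F, ⟨continuous_F, F_point⟩, fun F' hF' => (di.extend_unique hF'.2 hF'.1).symm,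
    fun γ => ⟨MetricGraph.exists_corresponds hconn γ, fun ω hω R hR =>
      hf.tendsto_of_corresponds continuous_F F_point hω hR⟩,
    ⟨_, Set.forall_mem_range.2 norm_F_le⟩, ?_, ciSup_le norm_F_le⟩
  rw [← di.dense.ciSup' continuous_F.norm, ← Set.rangeFactorization_surjective.iSup_comp]
  exact iSup_congr fun x => congrArg norm (F_point x).symm

theorem proposition3p4 {V : Type*} [Countable V] [Infinite V] (M : MetricGraph V)
    (hconn : M.graph.Connected) (hlf : ∀ v, (M.graph.neighborSet v).Finite)
    (f : M.Point → ℂ) (hf : MetricGraph.MemH1 f) :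
    ∃ F : M.EndCompactification → ℂ,
      -- `F` is a continuous extension of `f`, and the only one
      (Continuous F ∧ ∀ x, F (.point x) = f x) ∧
      (∀ F' : M.EndCompactification → ℂ,
        (Continuous F' ∧ ∀ x, F' (.point x) = f x) → F' = F) ∧
      -- its boundary values are the limits along the rays of the corresponding graph end
      (∀ γ : M.TopEnd,
        (∃ ω : GraphEnd M.graph, M.Corresponds γ ω) ∧
        ∀ ω : GraphEnd M.graph, M.Corresponds γ ω →
          ∀ R : GraphRay M.graph, R.BelongsTo ω →
            Tendsto (fun n => f (.vertex (R.vert n))) atTop (𝓝 (F (.topEnd γ)))) ∧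
      -- the supremum norms of `f` and `F` agree and obey the Sobolev bound
      BddAbove (Set.range fun z => ‖F z‖) ∧
      (⨆ x : M.Point, ‖f x‖) = (⨆ z : M.EndCompactification, ‖F z‖) ∧
      (⨆ z : M.EndCompactification, ‖F z‖) ≤ M.sobolevConst * MetricGraph.normH1 f := by
  exact proposition3p4_general M hconn f hf
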